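/- For $N\ge1$ let $\langle\cdot\rangle$ be the average over the Laguerre ensemble, i.e. over $y\in[0,\infty)^N$ with density proportional to $e^{-N\sum_i y_i}\prod_{i<j}(y_i-y_j)^2$, and write $\langle\mathrm{tr}\,H^m\rangle=\langle\sum_i y_i^m\rangle$. The one-loop mean $W_1(x)=\langle\mathrm{tr}\,(x-H)^{-1}\rangle$ is understood as the generating series $\sum_{m\ge0}\langle\mathrm{tr}\,H^m\rangle x^{-m-1}$. Its genus expansion is $W_1=\sum_{g\ge0}N^{1-2g}W_1^{(g)}$: there are numbers $c_m^{(g)}$ (the coefficients of the large-$N$ expansion of the moments), vanishing for $m<2g$, with $\langle\mathrm{tr}\,H^m\rangle=\sum_{0\le g\le m/2}N^{1-2g}c_m^{(g)}$ for all $N\ge1$, $m\ge0$, and $$W_1^{(g)}(x)=\sum_{m\ge0}c_m^{(g)}x^{-m-1},$$ a series that converges for $|x|>4$. Set $x=e^\lambda+e^{-\lambda}+2$ with $\operatorname{Re}\lambda>0$, write $W_1^{(g)}(\lambda)$ for $W_1^{(g)}(x)$, and put $v_k(\lambda)=\left(\frac{e^\lambda-1}{e^\lambda+1}\right)^{2k+1}$,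 $k\in\mathbb Z$. Then $W_1^{(g)}(\lambda)\to0$ as $\lambda\to+\infty$ along the reals, and there is a unique family of real numbers $a_k^{(g)}$ ($g\ge0$, $k\in\mathbb Z$, with $a_k^{(g)}=0$ unless $-3g\le k\le g$) such that for all $\lambda$ with $\operatorname{Re}\lambda>0$ and $|x|>4$ $$W_1^{(g)}(\lambda)=\frac{\delta_{g,0}}2+\sum_{k=-3g}^{g}a_k^{(g)}v_k(\lambda).$$ These coefficients are also the unique family, with $a_k^{(g)}=0$ unless $-3g\le k\le g$, such that $a_k^{(0)}=-\delta_{k,0}/2$; for all $g\ge1$ and all $k\ne0$ $$\begin{aligned}4k\,a_k^{(g)}={}&\frac{(2k+7)(2k+5)(2k+3)}{32}a_{k+3}^{(g-1)}-\frac{(2k+5)(2k+3)(k+1)}{4}a_{k+2}^{(g-1)}+\frac{3(2k+3)(2k+1)^2}{16}a_{k+1}^{(g-1)}\\&-\frac{(2k+1)k(2k-1)}{4}a_k^{(g-1)}+\frac{(2k-1)^2(2k-3)}{32}a_{k-1}^{(g-1)};\end{aligned}$$ and, for all $g\ge1$, $$\sum_{k=-3g}^{g}a_k^{(g)}=0.$$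 -/

import Mathlib

open MeasureTheory Filter Topology

noncomputable section

/-- The unnormalised eigenvalue density `e^{-N ∑ yᵢ} Δ(y)²` of the `N × N` Laguerre ensemble,
where `Δ(y) = ∏_{i<j} (yᵢ - yⱼ)`. -/
def laguerreWeight (N : ℕ) (y : Fin N → ℝ) : ℝ :=
  Real.exp (-(N : ℝ) * ∑ i, y i) * (∏ i, ∏ j ∈ Finset.Ioi i, (y i - y j)) ^ 2

/-- The partition function: the integral of the density over `[0,∞)^N`. -/
def laguerreZ (N : ℕ) : ℝ :=
  ∫ y in {y : Fin N → ℝ | ∀ i, 0 ≤ y i}, laguerreWeight N y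

/-- The mean `⟨tr f(H)⟩` of `tr f(H) = ∑ᵢ f(yᵢ)` in the Laguerre ensemble. -/
def laguerreTraceMean (N : ℕ) (f : ℝ → ℝ) : ℝ :=
  (1 / laguerreZ N) *
    ∫ y in {y : Fin N → ℝ | ∀ i, 0 ≤ y i}, laguerreWeight N y * ∑ i, f (y i)

/-- The moment `⟨tr H^m⟩`. The one-loop mean `W₁(x) = ⟨tr (x - H)⁻¹⟩` is the generating function
`∑_{m ≥ 0} ⟨tr H^m⟩ x^{-m-1}` of these moments. -/
def laguerreMoment (N m : ℕ) : ℝ :=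
  laguerreTraceMean N (fun t => t ^ m)

/-- The coefficient of `N^{1-2g}` in the large-`N` expansion of `⟨tr H^m⟩`, that is
`lim_{N → ∞} N^{2g-1} (⟨tr H^m⟩ - ∑_{h<g} N^{1-2h} c_h)`, where `c_h` are the previous
coefficients. -/
def genusCoeff (m : ℕ) (g : ℕ) : ℝ :=
  limUnder atTop (fun N : ℕ =>
    (N : ℝ) ^ (2 * (g : ℤ) - 1) *
      (laguerreMoment N m - ∑ h : Fin g, (N : ℝ) ^ (1 - 2 * ((h : ℕ) : ℤ)) * genusCoeff m h))
termination_by g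
decreasing_by exact h.2

/-- The terms of the series in `1/x` of the genus-`g` part of the one-loop mean. -/
def genusMeanTerm (g : ℕ) (x : ℂ) (m : ℕ) : ℂ :=
  (genusCoeff m g : ℂ) / x ^ (m + 1)

/-- The genus-`g` term `W₁^{(g)}(x)` of `W₁(x) = ∑_g N^{1-2g} W₁^{(g)}(x)`. -/
def genusMean (g : ℕ) (x : ℂ) : ℂ :=
  ∑' m : ℕ, genusMeanTerm g x m

/-- The change of variables `x = e^l + e^{-l} + 2`. -/
def spectralX (l : ℂ) : ℂ :=
  Complex.exp l + Complex.exp (-l) + 2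

/-- `v_k(l) = ((e^l - 1) / (e^l + 1))^{2k+1}`, for `k ∈ ℤ`. -/
def vFun (k : ℤ) (l : ℂ) : ℂ :=
  ((Complex.exp l - 1) / (Complex.exp l + 1)) ^ (2 * k + 1)

/-- `a g k` vanishes outside `-3g ≤ k ≤ g`. -/
def GenusSupported (a : ℕ → ℤ → ℝ) : Prop :=
  ∀ (g : ℕ) (k : ℤ), k < -3 * (g : ℤ) ∨ (g : ℤ) < k → a g k = 0

/-- The numbers `a g k`, `-3g ≤ k ≤ g`, are the coefficients of an expansion of all `W₁^{(g)}` in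
the functions `v_k`; in genus zero there is an additional constant `1/2`. The variable `l` ranges
over all values in the sheet `Re l > 0` at which the series in `1/x` is required to converge,
`|x| > 4`. -/
def IsVExpansion (a : ℕ → ℤ → ℝ) : Prop :=
  GenusSupported a ∧
  ∀ (g : ℕ) (l : ℂ), 0 < l.re → 4 < ‖spectralX l‖ →
    genusMean g (spectralX l) =
      (if g = 0 then 1 / 2 else 0) +
        ∑ k ∈ Finset.Icc (-3 * (g : ℤ)) (g : ℤ), (a g k : ℂ) * vFun k l

/-- The recursive determination of the coefficients: initial values, the five-term recursion at
`k ≠ 0`, and the vanishing of the sum of the coefficients in positive genus. -/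
def SatisfiesVRecursion (a : ℕ → ℤ → ℝ) : Prop :=
  GenusSupported a ∧
  (∀ k : ℤ, a 0 k = if k = 0 then -1 / 2 else 0) ∧
  (∀ (g : ℕ) (k : ℤ), 0 < g → k ≠ 0 →
    4 * (k : ℝ) * a g k =
      (2 * (k : ℝ) + 7) * (2 * k + 5) * (2 * k + 3) / 32 * a (g - 1) (k + 3)
      - (2 * (k : ℝ) + 5) * (2 * k + 3) * (k + 1) / 4 * a (g - 1) (k + 2)
      + 3 * (2 * (k : ℝ) + 3) * (2 * k + 1) ^ 2 / 16 * a (g - 1) (k + 1)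
      - (2 * (k : ℝ) + 1) * k * (2 * k - 1) / 4 * a (g - 1) k
      + (2 * (k : ℝ) - 1) ^ 2 * (2 * k - 3) / 32 * a (g - 1) (k - 1)) ∧
  (∀ g : ℕ, 0 < g → ∑ k ∈ Finset.Icc (-3 * (g : ℤ)) (g : ℤ), a g k = 0)

end

/-! The eigenvalue density is a squared determinant of Laguerre functions, so Andréief's identity
turns `⟨tr H^m⟩` into a one-variable moment of the kernel `∑_{k<N} L_k²`. Integration by parts
against `e^{-x}` gives these moments the three-term Haagerup–Thorbjørnsen recursion
(`kernelMoment_recursion`). After rescaling, `N` enters it only through `N^{-2}`, so comparing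
powers of `N` yields the genus expansion and a recursion for its coefficients in `m` and `g`.

On the other side, `((e^l-1)/(e^l+1))² = 1 - 4/x`, hence `v_k = (1-4z)^{k+1/2}` with `z = 1/x`. On
the Taylor coefficients of these functions, the transpose of the five-term operator acts as
multiplication by `-n²(n-1)` combined with a shift of the degree
(`fiveTermTranspose_halfBinomCoeff_succ`). Thus the series built from a solution of the five-term
recursion obeys the moment recursion, and the two families of coefficients agree by induction.

This transfer needs the five-term recursion at `k = 0` too, where it defines nothing and instead
demands that the right-hand side vanish. That solvability (`fiveTerm_vCoeff_zero`) follows from a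
symmetric bilinear form for which both sides of the recursion are skew operators. The coefficient at
`k = 0` is then fixed by the sum condition, which is decay at infinity. Uniqueness of the expansion
is linear independence of odd powers of `w` on `(0,1)`. -/

/-! ### Laguerre polynomials and algebraic integration against `e^{-x}`. -/

open Polynomial in
/-- The linear functional `X^k ↦ k!` on real polynomials, which is integration against `e^{-x}` on
`[0,∞)`. -/
noncomputable def factorialFunctional : ℝ[X] →ₗ[ℝ] ℝ :=
  Polynomial.lsum fun k => (k.factorial : ℝ) • LinearMap.id

open Polynomial in
theorem factorialFunctional_monomial (k : ℕ) (a : ℝ) :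
    factorialFunctional (monomial k a) = k.factorial * a := by
  simp [factorialFunctional, Polynomial.lsum_apply, Polynomial.sum_monomial_index]

open Polynomial in
theorem factorialFunctional_derivative (q : ℝ[X]) :
    factorialFunctional (derivative q) = factorialFunctional q - q.coeff 0 := by
  induction q using Polynomial.induction_on' with
  | add p q hp hq => simp only [map_add, hp, hq, coeff_add]; ring
  | monomial k a =>
    rw [derivative_monomial, factorialFunctional_monomial, factorialFunctional_monomial]
    cases k with
    | zero => simp
    | succ k => simp [coeff_monomial, Nat.factorial_succ]; ring

open Polynomial in
/-- The Laguerre polynomial `∑ (-1)^k (n choose k) x^k / k!`. -/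
noncomputable def laguerrePoly (n : ℕ) : ℝ[X] :=
  ∑ k ∈ Finset.range (n + 1), monomial k ((-1 : ℝ) ^ k * n.choose k / k.factorial)

theorem laguerrePoly_coeff (n k : ℕ) :
    (laguerrePoly n).coeff k = (-1 : ℝ) ^ k * n.choose k / k.factorial := by
  simp only [laguerrePoly, Polynomial.finsetSum_coeff, Polynomial.coeff_monomial,
    Finset.sum_ite_eq', Finset.mem_range]
  split_ifs with h
  · rfl
  · rw [Nat.choose_eq_zero_of_lt (by omega)]; simp

theorem laguerrePoly_natDegree_le (n : ℕ) : (laguerrePoly n).natDegree ≤ n := by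
  rw [Polynomial.natDegree_le_iff_coeff_eq_zero]
  intro k hk
  rw [laguerrePoly_coeff, Nat.choose_eq_zero_of_lt hk]; simp

theorem laguerrePoly_zero : laguerrePoly 0 = 1 := by
  simp [laguerrePoly]

open Polynomial in
theorem derivative_laguerrePoly_succ (n : ℕ) :
    derivative (laguerrePoly (n + 1)) = derivative (laguerrePoly n) - laguerrePoly n := by
  ext k
  rw [coeff_sub, coeff_derivative, coeff_derivative, laguerrePoly_coeff, laguerrePoly_coeff,
    laguerrePoly_coeff, Nat.choose_succ_succ, Nat.factorial_succ]
  push_cast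
  field_simp
  ring

open Polynomial in
theorem X_mul_derivative_laguerrePoly (n : ℕ) :
    X * derivative (laguerrePoly (n + 1)) =
      ((n : ℝ[X]) + 1) * (laguerrePoly (n + 1) - laguerrePoly n) := by
  have hc : ((n : ℝ[X]) + 1) = C ((n : ℝ) + 1) := by simp
  ext k
  rw [hc, coeff_C_mul, coeff_sub, laguerrePoly_coeff, laguerrePoly_coeff]
  cases k with
  | zero => simp
  | succ k =>
    rw [coeff_X_mul, coeff_derivative, laguerrePoly_coeff]
    have h1 := Nat.add_one_mul_choose_eq n k
    have h2 := Nat.choose_succ_succ n k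
    have h1' : ((n : ℝ) + 1) * n.choose k = (n + 1).choose (k + 1) * (k + 1) := by
      exact_mod_cast h1
    have h2' : ((n + 1).choose (k + 1) : ℝ) = n.choose k + n.choose (k + 1) := by
      exact_mod_cast h2
    have : (((k + 1).factorial : ℕ) : ℝ) ≠ 0 := by positivity
    field_simp
    linear_combination (-1 : ℝ) * h1' - (n + 1) * h2'

open Polynomial in
theorem X_mul_derivative_laguerrePoly' (n : ℕ) :
    X * derivative (laguerrePoly n) =
      ((n : ℝ[X]) + 1) * laguerrePoly (n + 1) - ((n : ℝ[X]) + 1 - X) * laguerrePoly n := by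
  linear_combination X_mul_derivative_laguerrePoly n - X * derivative_laguerrePoly_succ n

open Polynomial in
theorem laguerrePoly_three_term (n : ℕ) :
    ((n : ℝ[X]) + 2) * laguerrePoly (n + 2) =
      (2 * (n : ℝ[X]) + 3 - X) * laguerrePoly (n + 1) - ((n : ℝ[X]) + 1) * laguerrePoly n := by
  have h := X_mul_derivative_laguerrePoly' (n + 1)
  have h2 := X_mul_derivative_laguerrePoly n
  push_cast at h
  linear_combination h2 - h

open Polynomial in
theorem laguerrePoly_ode (n : ℕ) :
    derivative (X * derivative (laguerrePoly n)) =
      X * derivative (laguerrePoly n) - (n : ℝ[X]) * laguerrePoly n := by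
  cases n with
  | zero => simp [laguerrePoly_zero]
  | succ n =>
    rw [X_mul_derivative_laguerrePoly]
    have hd := derivative_laguerrePoly_succ n
    have h0 : derivative ((n : ℝ[X]) + 1) = 0 := by simp
    rw [derivative_mul, h0, derivative_sub]
    push_cast
    linear_combination ((n : ℝ[X]) + 1) * hd

open Polynomial in
theorem factorialFunctional_natCast_mul (n : ℕ) (q : ℝ[X]) :
    factorialFunctional ((n : ℝ[X]) * q) = n * factorialFunctional q := by
  rw [← nsmul_eq_mul, map_nsmul, nsmul_eq_mul]

-- Sturm–Liouville argument: `e^{-x} x (L_m' L_n - L_n' L_m)` has derivative `(n - m) e^{-x} L_m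
-- L_n` and vanishes at both ends of the half-line.
open Polynomial in
theorem factorialFunctional_laguerrePoly_mul_of_ne {m n : ℕ} (h : m ≠ n) :
    factorialFunctional (laguerrePoly m * laguerrePoly n) = 0 := by
  have key : derivative (X * derivative (laguerrePoly m) * laguerrePoly n -
        X * derivative (laguerrePoly n) * laguerrePoly m) -
      (X * derivative (laguerrePoly m) * laguerrePoly n -
        X * derivative (laguerrePoly n) * laguerrePoly m) =
      (n : ℝ[X]) * (laguerrePoly m * laguerrePoly n) -
        (m : ℝ[X]) * (laguerrePoly m * laguerrePoly n) := by
    rw [derivative_sub, derivative_mul (f := X * derivative (laguerrePoly m)),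
      derivative_mul (f := X * derivative (laguerrePoly n)), laguerrePoly_ode, laguerrePoly_ode]
    ring
  have := congrArg factorialFunctional key
  rw [map_sub, factorialFunctional_derivative, map_sub factorialFunctional (_ * _) (_ * _),
    map_sub factorialFunctional ((n : ℝ[X]) * _), factorialFunctional_natCast_mul,
    factorialFunctional_natCast_mul] at this
  simp only [coeff_sub, mul_assoc, coeff_X_mul_zero] at this
  have hmn : (n : ℝ) - m ≠ 0 := sub_ne_zero.mpr (by exact_mod_cast h.symm)
  apply mul_left_cancel₀ hmn
  linarith

theorem derivative_laguerrePoly_eq_sum (n : ℕ) :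
    Polynomial.derivative (laguerrePoly n) = -∑ k ∈ Finset.range n, laguerrePoly k := by
  induction n with
  | zero => simp [laguerrePoly_zero]
  | succ n ih => rw [derivative_laguerrePoly_succ, ih, Finset.sum_range_succ]; ring

-- Integrate the derivative of `e^{-x} L_{n+1} L_n`: the boundary value at `0` is `1`, and since
-- `L_{n+1}'` is minus the sum of all lower `L_k`, orthogonality leaves only the norm of `L_n`.
open Polynomial in
theorem factorialFunctional_laguerrePoly_sq (n : ℕ) :
    factorialFunctional (laguerrePoly n * laguerrePoly n) = 1 := by
  have h := factorialFunctional_derivative (laguerrePoly (n + 1) * laguerrePoly n)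
  have hc : (laguerrePoly (n + 1) * laguerrePoly n).coeff 0 = 1 := by
    simp [mul_coeff_zero, laguerrePoly_coeff]
  have h1 : factorialFunctional (derivative (laguerrePoly (n + 1)) * laguerrePoly n) =
      -factorialFunctional (laguerrePoly n * laguerrePoly n) := by
    rw [derivative_laguerrePoly_eq_sum, neg_mul, map_neg, Finset.sum_mul, map_sum,
      Finset.sum_range_succ, Finset.sum_eq_zero, zero_add]
    intro k hk
    exact factorialFunctional_laguerrePoly_mul_of_ne (Finset.mem_range.mp hk).ne
  have h2 : factorialFunctional (laguerrePoly (n + 1) * derivative (laguerrePoly n)) = 0 := by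
    rw [derivative_laguerrePoly_eq_sum, mul_neg, map_neg, Finset.mul_sum, map_sum,
      Finset.sum_eq_zero, neg_zero]
    intro k hk
    have := Finset.mem_range.mp hk
    exact factorialFunctional_laguerrePoly_mul_of_ne (by omega)
  rw [derivative_mul, map_add, h1, h2, hc,
    factorialFunctional_laguerrePoly_mul_of_ne (Nat.succ_ne_self n)] at h
  linarith

/-! ### The Christoffel–Darboux kernel and the recursion for its moments. -/

open Polynomial in
/-- The Christoffel–Darboux kernel on the diagonal. -/
noncomputable def laguerreKernel (n : ℕ) : ℝ[X] :=
  ∑ k ∈ Finset.range n, laguerrePoly k * laguerrePoly k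

open Polynomial in
theorem X_mul_laguerreKernel (n : ℕ) :
    X * laguerreKernel (n + 1) = ((n : ℝ[X]) + 1) * (((n : ℝ[X]) + 1) *
      (laguerrePoly (n + 1) - laguerrePoly n) ^ 2 + X * laguerrePoly (n + 1) * laguerrePoly n) := by
  induction n with
  | zero =>
    have h1 : laguerrePoly 1 = 1 - X := by
      simp [laguerrePoly, Finset.sum_range_succ, ← C_mul_X_pow_eq_monomial]
      ring
    simp [laguerreKernel, laguerrePoly_zero, h1]
    ring
  | succ n ih =>
    rw [laguerreKernel, Finset.sum_range_succ, ← laguerreKernel, mul_add, ih]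
    have h3 := laguerrePoly_three_term n
    push_cast
    generalize laguerrePoly (n + 1 + 1) = S at *
    generalize laguerrePoly (n + 1) = P at *
    generalize laguerrePoly n = Q at *
    linear_combination (-((n : ℝ[X]) + 2) * (S - P) - (((n : ℝ[X]) + 1) * (P - Q) - X * P)
      - X * P) * h3

-- Equivalently `(e^{-x} x K)' = (n+1) e^{-x} L_{n+1} L_n`: the derivative of the kernel density
-- collapses to one product, which makes integration by parts effective.
open Polynomial in
theorem derivative_X_mul_laguerreKernel (n : ℕ) :
    derivative (X * laguerreKernel (n + 1)) = X * laguerreKernel (n + 1) +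
      ((n : ℝ[X]) + 1) * (laguerrePoly (n + 1) * laguerrePoly n) := by
  apply mul_left_cancel₀ (X_ne_zero (R := ℝ))
  have hP := X_mul_derivative_laguerrePoly n
  have hQ := X_mul_derivative_laguerrePoly' n
  rw [X_mul_laguerreKernel]
  simp only [derivative_mul, derivative_add, derivative_sub, derivative_pow, derivative_natCast,
    derivative_one, derivative_X]
  generalize derivative (laguerrePoly (n + 1)) = P' at *
  generalize derivative (laguerrePoly n) = Q' at *
  generalize laguerrePoly (n + 1) = P at *
  generalize laguerrePoly n = Q at *
  simp only [Nat.cast_ofNat, C_ofNat]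
  ring_nf at hP hQ ⊢
  linear_combination (((n : ℝ[X]) + 1) * (((n : ℝ[X]) + 1) * (2 * (P - Q)) + X * Q)) * hP +
    (((n : ℝ[X]) + 1) * (-((n : ℝ[X]) + 1) * (2 * (P - Q)) + X * P)) * hQ

-- Needed for the first moment: `kernelMoment_recursion` starts at the second moment, and its `p =
-- 0` case does not involve the zeroth one.
open Polynomial in
theorem factorialFunctional_X_mul_laguerreKernel (n : ℕ) :
    factorialFunctional (X * laguerreKernel (n + 1)) =
      2 * ((n : ℝ) + 1) * factorialFunctional (laguerreKernel (n + 1)) +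
      ((n : ℝ) + 1) * factorialFunctional (X * (laguerrePoly (n + 1) * laguerrePoly n)) := by
  have hP := X_mul_derivative_laguerrePoly n
  have hQ := X_mul_derivative_laguerrePoly' n
  have hK := X_mul_laguerreKernel n
  have hE := factorialFunctional_laguerrePoly_mul_of_ne (Nat.succ_ne_self n)
  have hd := factorialFunctional_derivative
    (laguerrePoly (n + 1) * laguerrePoly (n + 1) - laguerrePoly n * laguerrePoly n)
  have hc : (laguerrePoly (n + 1) * laguerrePoly (n + 1) - laguerrePoly n * laguerrePoly n).coeff 0
      = 0 := by
    simp [mul_coeff_zero, laguerrePoly_coeff]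
  rw [hc, sub_zero, derivative_sub, derivative_mul, derivative_mul] at hd
  have key : C (((n : ℝ) + 1) ^ 2) * (derivative (laguerrePoly (n + 1)) * laguerrePoly (n + 1) +
      laguerrePoly (n + 1) * derivative (laguerrePoly (n + 1)) -
      (derivative (laguerrePoly n) * laguerrePoly n +
      laguerrePoly n * derivative (laguerrePoly n))) =
      C (((n : ℝ) + 1) ^ 2) *
        (laguerrePoly (n + 1) * laguerrePoly (n + 1) - laguerrePoly n * laguerrePoly n) +
      C (2 * ((n : ℝ) + 1)) * laguerreKernel (n + 1) - X * laguerreKernel (n + 1) +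
      C ((n : ℝ) + 1) * (X * (laguerrePoly (n + 1) * laguerrePoly n)) -
      C (4 * ((n : ℝ) + 1) ^ 2) * (laguerrePoly (n + 1) * laguerrePoly n) := by
    apply mul_left_cancel₀ (X_ne_zero (R := ℝ))
    simp only [map_add, map_mul, map_pow, map_natCast, map_one, C_ofNat]
    generalize derivative (laguerrePoly (n + 1)) = P' at *
    generalize derivative (laguerrePoly n) = Q' at *
    generalize laguerrePoly (n + 1) = P at *
    generalize laguerrePoly n = Q at *
    linear_combination (2 * ((n : ℝ[X]) + 1) ^ 2 * P) * hP - (2 * ((n : ℝ[X]) + 1) ^ 2 * Q) * hQ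
      - (2 * ((n : ℝ[X]) + 1) - X) * hK
  have := congrArg factorialFunctional key
  simp only [← smul_eq_C_mul] at this
  rw [map_smul, hd] at this
  simp only [map_sub, map_add, map_smul, smul_eq_mul, hE] at this
  linarith

open Polynomial in
theorem factorialFunctional_X_pow_mul_christoffel (n p : ℕ) :
    (p : ℝ) * factorialFunctional (X ^ p * laguerreKernel (n + 1)) +
      ((n : ℝ) + 1) * factorialFunctional (X ^ p * (laguerrePoly (n + 1) * laguerrePoly n)) = 0 := by
  have hd := factorialFunctional_derivative (X ^ p * (X * laguerreKernel (n + 1)))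
  have hX : (p : ℝ[X]) * X ^ (p - 1) * X = (p : ℝ[X]) * X ^ p := by
    cases p with
    | zero => simp
    | succ p => simp [pow_succ, mul_assoc]
  have key : derivative (X ^ p * (X * laguerreKernel (n + 1))) = X ^ p * (X * laguerreKernel (n + 1))
      + C (p : ℝ) * (X ^ p * laguerreKernel (n + 1)) +
      C ((n : ℝ) + 1) * (X ^ p * (laguerrePoly (n + 1) * laguerrePoly n)) := by
    rw [derivative_mul, derivative_X_mul_laguerreKernel, derivative_X_pow]
    simp only [map_add, map_natCast, map_one]
    linear_combination laguerreKernel (n + 1) * hX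
  have hc : (X ^ p * (X * laguerreKernel (n + 1))).coeff 0 = 0 := by
    simp [mul_coeff_zero]
  rw [hc, key] at hd
  simp only [← smul_eq_C_mul] at hd
  simp only [map_add, map_smul, smul_eq_mul] at hd
  linarith

open Polynomial in
/-- The moment `∫ x^p e^{-x} ∑_{k < n} L_k(x)^2 dx`. -/
noncomputable def kernelMoment (n p : ℕ) : ℝ :=
  factorialFunctional (X ^ p * laguerreKernel n)

theorem kernelMoment_zero_right (n : ℕ) : kernelMoment n 0 = n := by
  simp [kernelMoment, laguerreKernel, factorialFunctional_laguerrePoly_sq]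

theorem kernelMoment_one_right (n : ℕ) : kernelMoment (n + 1) 1 = ((n : ℝ) + 1) ^ 2 := by
  have h0 := kernelMoment_zero_right (n + 1)
  have h1 := factorialFunctional_X_mul_laguerreKernel n
  have h2 := factorialFunctional_X_pow_mul_christoffel n 1
  simp only [kernelMoment, pow_zero, one_mul, pow_one] at *
  push_cast at *
  rw [h0] at h1
  linarith

open Polynomial in
theorem factorialFunctional_X_pow_mul_sq_sub_sq (n p : ℕ) :
    ((p : ℝ) + 1) * factorialFunctional (X ^ p * (laguerrePoly (n + 1) * laguerrePoly n)) +
      ((n : ℝ) + 1) * factorialFunctional (X ^ p *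
        (laguerrePoly (n + 1) * laguerrePoly (n + 1) - laguerrePoly n * laguerrePoly n)) = 0 := by
  have hd := factorialFunctional_derivative (X ^ (p + 1) * (laguerrePoly (n + 1) * laguerrePoly n))
  have key : derivative (X ^ (p + 1) * (laguerrePoly (n + 1) * laguerrePoly n)) =
      X ^ (p + 1) * (laguerrePoly (n + 1) * laguerrePoly n)
      + C ((p : ℝ) + 1) * (X ^ p * (laguerrePoly (n + 1) * laguerrePoly n)) +
      C ((n : ℝ) + 1) * (X ^ p *
        (laguerrePoly (n + 1) * laguerrePoly (n + 1) - laguerrePoly n * laguerrePoly n)) := by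
    rw [derivative_mul, derivative_X_pow, derivative_mul]
    simp only [map_add, map_natCast, map_one, Nat.add_sub_cancel, Nat.cast_add, Nat.cast_one]
    linear_combination X ^ p * laguerrePoly n * X_mul_derivative_laguerrePoly n +
      X ^ p * laguerrePoly (n + 1) * X_mul_derivative_laguerrePoly' n
  have hc : (X ^ (p + 1) * (laguerrePoly (n + 1) * laguerrePoly n)).coeff 0 = 0 := by
    simp [mul_coeff_zero]
  rw [hc, key] at hd
  simp only [← smul_eq_C_mul] at hd
  simp only [map_add, map_smul, smul_eq_mul] at hd
  linarith

open Polynomial in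
/-- The Haagerup–Thorbjørnsen recursion. -/
theorem kernelMoment_recursion (n p : ℕ) :
    ((p : ℝ) + 3) * kernelMoment (n + 1) (p + 2) =
      (4 * p + 6) * ((n : ℝ) + 1) * kernelMoment (n + 1) (p + 1) +
      ((p : ℝ) + 1) ^ 2 * p * kernelMoment (n + 1) p := by
  have hP := X_mul_derivative_laguerrePoly n
  have hQ := X_mul_derivative_laguerrePoly' n
  have hK := X_mul_laguerreKernel n
  have hE0 := factorialFunctional_X_pow_mul_christoffel n p
  have hE1 := factorialFunctional_X_pow_mul_christoffel n (p + 1)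
  have hE2 := factorialFunctional_X_pow_mul_christoffel n (p + 2)
  have hG := factorialFunctional_X_pow_mul_sq_sub_sq n p
  have hd := factorialFunctional_derivative (X ^ (p + 1) *
    (laguerrePoly (n + 1) * laguerrePoly (n + 1) - laguerrePoly n * laguerrePoly n))
  have hc : (X ^ (p + 1) * (laguerrePoly (n + 1) * laguerrePoly (n + 1) -
      laguerrePoly n * laguerrePoly n)).coeff 0 = 0 := by
    simp [mul_coeff_zero]
  -- The closed form of `X * K` removes `(P - Q)²`, hence `P² + Q²`. Only `K`, `PQ` and `P² - Q²`
  -- remain, and the last two are eliminated by `hE0`, `hE1`, `hE2` and `hG`.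
  have key : C (((n : ℝ) + 1) ^ 2) * derivative (X ^ (p + 1) *
      (laguerrePoly (n + 1) * laguerrePoly (n + 1) - laguerrePoly n * laguerrePoly n)) =
      C (((n : ℝ) + 1) ^ 2) * (X ^ (p + 1) *
        (laguerrePoly (n + 1) * laguerrePoly (n + 1) - laguerrePoly n * laguerrePoly n)) +
      C (((n : ℝ) + 1) ^ 2 * (p + 1)) * (X ^ p *
        (laguerrePoly (n + 1) * laguerrePoly (n + 1) - laguerrePoly n * laguerrePoly n)) +
      C (2 * ((n : ℝ) + 1)) * (X ^ (p + 1) * laguerreKernel (n + 1)) -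
      X ^ (p + 2) * laguerreKernel (n + 1) +
      C ((n : ℝ) + 1) * (X ^ (p + 2) * (laguerrePoly (n + 1) * laguerrePoly n)) -
      C (4 * ((n : ℝ) + 1) ^ 2) * (X ^ (p + 1) * (laguerrePoly (n + 1) * laguerrePoly n)) := by
    rw [derivative_mul, derivative_X_pow, derivative_sub, derivative_mul, derivative_mul]
    simp only [map_add, map_mul, map_pow, map_natCast, map_one, C_ofNat, Nat.add_sub_cancel,
      Nat.cast_add, Nat.cast_one]
    generalize derivative (laguerrePoly (n + 1)) = P' at *
    generalize derivative (laguerrePoly n) = Q' at *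
    generalize laguerrePoly (n + 1) = P at *
    generalize laguerrePoly n = Q at *
    linear_combination (2 * ((n : ℝ[X]) + 1) ^ 2 * P * X ^ p) * hP
      - (2 * ((n : ℝ[X]) + 1) ^ 2 * Q * X ^ p) * hQ - (2 * ((n : ℝ[X]) + 1) - X) * X ^ p * hK
  have h := congrArg factorialFunctional key
  simp only [← smul_eq_C_mul] at h
  rw [map_smul, hd, hc] at h
  simp only [map_sub factorialFunctional (_ + _), map_add, map_smul, smul_eq_mul] at h
  simp only [kernelMoment]
  have hn : (n : ℝ) + 1 ≠ 0 := by positivity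
  push_cast at *
  generalize factorialFunctional (X ^ (p + 1) * laguerreKernel (n + 1)) = D1 at *
  generalize factorialFunctional (X ^ (p + 2) * laguerreKernel (n + 1)) = D2 at *
  generalize factorialFunctional (X ^ p * laguerreKernel (n + 1)) = D0 at *
  linear_combination h + hE2 - 4 * (n + 1) * hE1 + (n + 1) * (p + 1) * hG
    - (p + 1) ^ 2 * hE0

/-! ### From the matrix ensemble to the kernel moments. -/

open Polynomial in
theorem det_eval_eq_det_vandermonde_mul {n : ℕ} (v : Fin n → ℝ) (p : ℕ → ℝ[X])
    (hdeg : ∀ i, (p i).natDegree ≤ i) :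
    (Matrix.of fun i j : Fin n => (p j).eval (v i)).det =
      (Matrix.vandermonde v).det * ∏ i : Fin n, (p i).coeff i := by
  rw [Matrix.eval_matrixOfPolynomials_eq_vandermonde_mul_matrixOfPolynomials v (fun j => p j)
    (fun i => hdeg i), Matrix.det_mul, Matrix.det_of_isUpperTriangular
    (M := Matrix.of fun i j : Fin n => (p j).coeff i)]
  · simp
  · intro i j hij
    exact coeff_eq_zero_of_natDegree_lt ((hdeg j).trans_lt hij)

/-- Andréief's identity for the mean of a linear statistic, for an orthogonal family of functions
of constant norm. -/
theorem integral_sum_mul_det_sq {n : ℕ} (μ : Measure ℝ) [SigmaFinite μ] (φ : Fin n → ℝ → ℝ)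
    (f : ℝ → ℝ) (h : ℝ) (hφ : ∀ i j, Integrable (fun x => φ i x * φ j x) μ)
    (hf : ∀ i j, Integrable (fun x => f x * (φ i x * φ j x)) μ)
    (horth : ∀ i j, ∫ x, φ i x * φ j x ∂μ = if i = j then h else 0) :
    ∫ y : Fin n → ℝ, (Matrix.of fun i j => φ j (y i)).det ^ 2 * ∑ i, f (y i)
        ∂(Measure.pi fun _ => μ) =
      n.factorial * h ^ (n - 1) * ∑ j, ∫ x, f x * (φ j x * φ j x) ∂μ := by
  classical
  have hg : ∀ (l : Fin n) (σ τ : Equiv.Perm (Fin n)) (i : Fin n),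
      Integrable (fun x => (if i = l then f x else 1) * (φ (σ i) x * φ (τ i) x)) μ := by
    intro l σ τ i
    split_ifs
    · exact hf _ _
    · simpa using hφ _ _
  have hexp : ∀ y : Fin n → ℝ,
      (Matrix.of fun i j => φ j (y i)).det ^ 2 * ∑ i, f (y i) =
      ∑ l, ∑ σ : Equiv.Perm (Fin n), ∑ τ : Equiv.Perm (Fin n),
        ((Equiv.Perm.sign σ : ℤ) : ℝ) * ((Equiv.Perm.sign τ : ℤ) : ℝ) *
        ∏ i, (if i = l then f (y i) else 1) * (φ (σ i) (y i) * φ (τ i) (y i)) := by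
    intro y
    rw [← Matrix.det_transpose, Matrix.det_apply', sq, Finset.sum_mul_sum, Finset.mul_sum]
    refine Finset.sum_congr rfl fun l _ => ?_
    rw [Finset.sum_mul]
    refine Finset.sum_congr rfl fun σ _ => ?_
    rw [Finset.sum_mul]
    refine Finset.sum_congr rfl fun τ _ => ?_
    simp only [Finset.prod_mul_distrib, Finset.prod_ite_eq', Finset.mem_univ, if_true,
      Matrix.transpose_apply, Matrix.of_apply]
    ring
  have hterm : ∀ (l : Fin n) (σ τ : Equiv.Perm (Fin n)),
      ((Equiv.Perm.sign σ : ℤ) : ℝ) * ((Equiv.Perm.sign τ : ℤ) : ℝ) *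
        ∏ i, ∫ x, (if i = l then f x else 1) * (φ (σ i) x * φ (τ i) x) ∂μ =
      if τ = σ then h ^ (n - 1) * ∫ x, f x * (φ (σ l) x * φ (σ l) x) ∂μ else 0 := by
    intro l σ τ
    split_ifs with hστ
    · subst hστ
      have hs : ((Equiv.Perm.sign τ : ℤ) : ℝ) * ((Equiv.Perm.sign τ : ℤ) : ℝ) = 1 := by
        rcases Int.units_eq_one_or (Equiv.Perm.sign τ) with h | h <;> simp [h]
      rw [hs, one_mul, ← Finset.mul_prod_erase _ _ (Finset.mem_univ l), mul_comm]
      congr 1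
      · rw [Finset.prod_congr rfl (g := fun _ => h), Finset.prod_const,
          Finset.card_erase_of_mem (Finset.mem_univ l), Finset.card_univ, Fintype.card_fin]
        intro i hi
        simp [Finset.ne_of_mem_erase hi, horth]
      · simp
    -- Distinct permutations differ in at least two places, hence somewhere away from `l`; there the
    -- factor is a plain inner product and vanishes.
    · have : ∃ i, i ≠ l ∧ σ i ≠ τ i := by
        by_contra! hall
        apply hστ
        have hl : σ l = τ l := by
          by_contra hne
          have h1 : σ (σ⁻¹ (τ l)) = τ l := by simp
          by_cases h2 : σ⁻¹ (τ l) = l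
          · rw [h2] at h1; exact hne h1
          · rw [hall _ h2] at h1
            exact h2 (τ.injective h1)
        ext i
        by_cases hi : i = l
        · rw [hi, hl]
        · rw [hall i hi]
      obtain ⟨i, hi, hne⟩ := this
      rw [Finset.prod_eq_zero (Finset.mem_univ i), mul_zero]
      simp [hi, horth, hne]
  have hint : ∀ (l : Fin n) (σ τ : Equiv.Perm (Fin n)), Integrable (fun y : Fin n → ℝ =>
      ((Equiv.Perm.sign σ : ℤ) : ℝ) * ((Equiv.Perm.sign τ : ℤ) : ℝ) *
        ∏ i, (if i = l then f (y i) else 1) * (φ (σ i) (y i) * φ (τ i) (y i)))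
      (Measure.pi fun _ => μ) :=
    fun l σ τ => (Integrable.fintype_prod (hg l σ τ)).const_mul _
  simp_rw [hexp]
  rw [integral_finsetSum _ fun l _ => integrable_finsetSum _ fun σ _ =>
    integrable_finsetSum _ fun τ _ => hint l σ τ]
  have hl : ∀ l : Fin n, ∫ y : Fin n → ℝ, ∑ σ : Equiv.Perm (Fin n), ∑ τ : Equiv.Perm (Fin n),
        ((Equiv.Perm.sign σ : ℤ) : ℝ) * ((Equiv.Perm.sign τ : ℤ) : ℝ) *
        ∏ i, (if i = l then f (y i) else 1) * (φ (σ i) (y i) * φ (τ i) (y i))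
        ∂(Measure.pi fun _ => μ) = ∑ σ : Equiv.Perm (Fin n),
        h ^ (n - 1) * ∫ x, f x * (φ (σ l) x * φ (σ l) x) ∂μ := by
    intro l
    rw [integral_finsetSum _ fun σ _ => integrable_finsetSum _ fun τ _ => hint l σ τ]
    refine Finset.sum_congr rfl fun σ _ => ?_
    rw [integral_finsetSum _ fun τ _ => hint l σ τ]
    have hτ : ∀ τ : Equiv.Perm (Fin n), ∫ y : Fin n → ℝ,
        ((Equiv.Perm.sign σ : ℤ) : ℝ) * ((Equiv.Perm.sign τ : ℤ) : ℝ) *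
          ∏ i, (if i = l then f (y i) else 1) * (φ (σ i) (y i) * φ (τ i) (y i))
          ∂(Measure.pi fun _ => μ) =
        if τ = σ then h ^ (n - 1) * ∫ x, f x * (φ (σ l) x * φ (σ l) x) ∂μ else 0 := by
      intro τ
      rw [integral_const_mul, integral_fintype_prod_eq_prod (fun (i : Fin n) x =>
        (if i = l then f x else 1) * (φ (σ i) x * φ (τ i) x)), hterm]
    simp_rw [hτ]
    simp
  simp_rw [hl]
  rw [Finset.sum_comm]
  simp_rw [← Finset.mul_sum]
  have hσ : ∀ σ : Equiv.Perm (Fin n), ∑ l, ∫ x, f x * (φ (σ l) x * φ (σ l) x) ∂μ =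
      ∑ j, ∫ x, f x * (φ j x * φ j x) ∂μ :=
    fun σ => Equiv.sum_comp σ fun j => ∫ x, f x * (φ j x * φ j x) ∂μ
  simp_rw [hσ]
  simp [Fintype.card_perm]
  ring

theorem integrableOn_pow_mul_exp_neg_mul (k : ℕ) {c : ℝ} (hc : 0 < c) :
    IntegrableOn (fun x : ℝ => x ^ k * Real.exp (-c * x)) (Set.Ioi 0) := by
  have := integrableOn_rpow_mul_exp_neg_mul_rpow (s := k) (p := 1) (b := c)
    (by linarith [Nat.cast_nonneg (α := ℝ) k]) one_pos hc
  simpa using this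

theorem integral_pow_mul_exp_neg_mul (k : ℕ) {c : ℝ} (hc : 0 < c) :
    ∫ x in Set.Ioi 0, x ^ k * Real.exp (-c * x) = k.factorial / c ^ (k + 1) := by
  have h := Real.integral_rpow_mul_exp_neg_mul_Ioi (a := k + 1) (r := c) (by positivity) hc
  rw [add_sub_cancel_right, Real.Gamma_nat_eq_factorial] at h
  simp only [Real.rpow_natCast, ← neg_mul] at h
  rw [h]
  have : (1 / c) ^ ((k : ℝ) + 1) = (1 / c) ^ (k + 1) := by exact_mod_cast Real.rpow_natCast _ (k + 1)
  rw [this, one_div, inv_pow]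
  ring

open Polynomial in
theorem integrableOn_eval_mul_exp {c : ℝ} (hc : 0 < c) (q : ℝ[X]) :
    IntegrableOn (fun x => q.eval (c * x) * Real.exp (-c * x)) (Set.Ici 0) := by
  rw [integrableOn_Ici_iff_integrableOn_Ioi]
  simp only [eval_eq_sum_range, Finset.sum_mul]
  refine integrable_finsetSum _ fun k _ => ?_
  refine ((integrableOn_pow_mul_exp_neg_mul k hc).const_mul (q.coeff k * c ^ k)).congr ?_
  refine Eventually.of_forall fun x => ?_
  simp only [mul_pow]
  ring

open Polynomial in
theorem integral_eval_mul_exp {c : ℝ} (hc : 0 < c) (q : ℝ[X]) :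
    ∫ x in Set.Ici 0, q.eval (c * x) * Real.exp (-c * x) = factorialFunctional q / c := by
  induction q using Polynomial.induction_on' with
  | add p q hp hq =>
    simp only [eval_add, add_mul]
    rw [integral_add (integrableOn_eval_mul_exp hc p) (integrableOn_eval_mul_exp hc q),
      hp, hq, map_add, add_div]
  | monomial k a =>
    rw [integral_Ici_eq_integral_Ioi, factorialFunctional_monomial]
    have : ∀ x : ℝ, (monomial k a).eval (c * x) * Real.exp (-c * x) =
        (a * c ^ k) * (x ^ k * Real.exp (-c * x)) := by
      intro x; rw [eval_monomial, mul_pow]; ring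
    simp_rw [this]
    rw [integral_const_mul, integral_pow_mul_exp_neg_mul k hc]
    field_simp
    ring

/-- The orthogonal functions of the Laguerre ensemble with weight `e^{-c x}`. -/
noncomputable def laguerreFunction (c : ℝ) (n : ℕ) (x : ℝ) : ℝ :=
  (laguerrePoly n).eval (c * x) * Real.exp (-c * x / 2)

open Polynomial in
theorem pow_mul_laguerreFunction_mul {c : ℝ} (hc : 0 < c) (p m n : ℕ) (x : ℝ) :
    x ^ p * (laguerreFunction c m x * laguerreFunction c n x) =
      (1 / c ^ p) * ((X ^ p * (laguerrePoly m * laguerrePoly n)).eval (c * x) *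
        Real.exp (-c * x)) := by
  have : Real.exp (-c * x) = Real.exp (-c * x / 2) * Real.exp (-c * x / 2) := by
    rw [← Real.exp_add]; ring_nf
  simp only [laguerreFunction, this, eval_mul, eval_pow, eval_X, mul_pow]
  field_simp

theorem integrableOn_pow_mul_laguerreFunction_mul {c : ℝ} (hc : 0 < c) (p m n : ℕ) :
    IntegrableOn (fun x => x ^ p * (laguerreFunction c m x * laguerreFunction c n x))
      (Set.Ici 0) := by
  simp_rw [pow_mul_laguerreFunction_mul hc]
  exact (integrableOn_eval_mul_exp hc _).const_mul _

open Polynomial in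
theorem integral_pow_mul_laguerreFunction_mul {c : ℝ} (hc : 0 < c) (p m n : ℕ) :
    ∫ x in Set.Ici 0, x ^ p * (laguerreFunction c m x * laguerreFunction c n x) =
      factorialFunctional (X ^ p * (laguerrePoly m * laguerrePoly n)) / c ^ (p + 1) := by
  simp_rw [pow_mul_laguerreFunction_mul hc]
  rw [integral_const_mul, integral_eval_mul_exp hc]
  field_simp
  ring

theorem prod_laguerrePoly_coeff_ne_zero (n : ℕ) : ∏ i : Fin n, (laguerrePoly i).coeff i ≠ 0 := by
  rw [Finset.prod_ne_zero_iff]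
  intro i _
  rw [laguerrePoly_coeff]
  simp [Nat.factorial_ne_zero]

/-- The Laguerre weight is, up to a constant, the square of a determinant of orthogonal
functions. -/
theorem exists_laguerreWeight_eq (N : ℕ) (hN : 1 ≤ N) : ∃ C : ℝ, C ≠ 0 ∧ ∀ y : Fin N → ℝ,
    laguerreWeight N y =
      C * (Matrix.of fun i j : Fin N => laguerreFunction N j (y i)).det ^ 2 := by
  have hN' : (N : ℝ) ≠ 0 := by positivity
  -- `a` collects the leading coefficients of the polynomials, `b` the factors `N` from rescaling
  -- the nodes of the Vandermonde determinant.
  set a : ℝ := ∏ i : Fin N, (laguerrePoly i).coeff i with ha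
  set b : ℝ := ∏ i : Fin N, ∏ _j ∈ Finset.Ioi i, (N : ℝ) with hb
  have ha0 : a ≠ 0 := prod_laguerrePoly_coeff_ne_zero N
  have hb0 : b ≠ 0 := by
    simp [hb, Finset.prod_ne_zero_iff]; omega
  refine ⟨1 / (a * b) ^ 2, by positivity, fun y => ?_⟩
  have h1 : (Matrix.of fun i j : Fin N => laguerreFunction N j (y i)).det =
      (∏ i, Real.exp (-N * y i / 2)) *
        (Matrix.of fun i j : Fin N => (laguerrePoly j).eval (N * y i)).det := by
    rw [← Matrix.det_mul_column]
    congr 1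
    ext i j
    simp [laguerreFunction, mul_comm]
  have h2 : (Matrix.vandermonde fun i => (N : ℝ) * y i).det =
      b * ∏ i : Fin N, ∏ j ∈ Finset.Ioi i, (y j - y i) := by
    rw [Matrix.det_vandermonde, hb, ← Finset.prod_mul_distrib]
    refine Finset.prod_congr rfl fun i _ => ?_
    rw [← Finset.prod_mul_distrib]
    exact Finset.prod_congr rfl fun j _ => by ring
  have h3 : (∏ i : Fin N, ∏ j ∈ Finset.Ioi i, (y i - y j)) ^ 2 =
      (∏ i : Fin N, ∏ j ∈ Finset.Ioi i, (y j - y i)) ^ 2 := by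
    simp only [← Finset.prod_pow]
    exact Finset.prod_congr rfl fun i _ => Finset.prod_congr rfl fun j _ => by ring
  have h4 : (∏ i, Real.exp (-N * y i / 2)) ^ 2 = Real.exp (-(N : ℝ) * ∑ i, y i) := by
    rw [← Real.exp_sum, ← Real.exp_nat_mul, Finset.mul_sum, Finset.mul_sum]
    congr 1
    exact Finset.sum_congr rfl fun i _ => by push_cast; ring
  rw [h1, det_eval_eq_det_vandermonde_mul (fun i => N * y i) laguerrePoly
    laguerrePoly_natDegree_le, h2, laguerreWeight, h3, ← h4, ← ha]
  field_simp

theorem setIntegral_laguerreWeight_mul_sum_pow (N p : ℕ) (hN : 1 ≤ N) :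
    ∫ y in {y : Fin N → ℝ | ∀ i, 0 ≤ y i},
      (Matrix.of fun i j : Fin N => laguerreFunction N j (y i)).det ^ 2 * ∑ i, y i ^ p =
      N.factorial * (1 / (N : ℝ)) ^ (N - 1) * (kernelMoment N p / (N : ℝ) ^ (p + 1)) := by
  have hN' : (0 : ℝ) < N := by exact_mod_cast hN
  have hset : {y : Fin N → ℝ | ∀ i, 0 ≤ y i} = Set.univ.pi fun _ => Set.Ici 0 := by
    ext y; simp [Pi.le_def]
  rw [hset, volume_pi, Measure.restrict_pi_pi,
    integral_sum_mul_det_sq (volume.restrict (Set.Ici 0)) (fun j => laguerreFunction N j)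
      (fun x => x ^ p) (1 / N)
      (fun i j => by simpa using! integrableOn_pow_mul_laguerreFunction_mul hN' 0 i j)
      (fun i j => integrableOn_pow_mul_laguerreFunction_mul hN' p i j)]
  · congr 1
    simp_rw [integral_pow_mul_laguerreFunction_mul hN']
    rw [← Finset.sum_div, kernelMoment, laguerreKernel, Finset.mul_sum, map_sum,
      ← Fin.sum_univ_eq_sum_range
        (fun k => factorialFunctional (Polynomial.X ^ p * (laguerrePoly k * laguerrePoly k)))]
  · intro i j
    have := integral_pow_mul_laguerreFunction_mul hN' 0 i j
    simp only [pow_zero, one_mul, zero_add, pow_one] at this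
    rw [this]
    split_ifs with h
    · rw [h, factorialFunctional_laguerrePoly_sq]
    · rw [factorialFunctional_laguerrePoly_mul_of_ne (by omega), zero_div]

theorem laguerreMoment_eq (N m : ℕ) (hN : 1 ≤ N) :
    laguerreMoment N m = kernelMoment N m / (N : ℝ) ^ m := by
  have hN' : (0 : ℝ) < N := by exact_mod_cast hN
  obtain ⟨C, hC, hw⟩ := exists_laguerreWeight_eq N hN
  have key : ∀ p, ∫ y in {y : Fin N → ℝ | ∀ i, 0 ≤ y i}, laguerreWeight N y * ∑ i, y i ^ p =
      C * (N.factorial * (1 / (N : ℝ)) ^ (N - 1) * (kernelMoment N p / (N : ℝ) ^ (p + 1))) := by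
    intro p
    rw [← setIntegral_laguerreWeight_mul_sum_pow N p hN, ← integral_const_mul]
    simp_rw [hw, mul_assoc]
  -- The zeroth moment is `N` times the partition function, so the normalisation comes from the same
  -- formula and the unknown constants cancel.
  have hZ : laguerreZ N * N =
      C * (N.factorial * (1 / (N : ℝ)) ^ (N - 1)) := by
    have := key 0
    simp only [pow_zero, Finset.sum_const, Finset.card_univ, Fintype.card_fin, nsmul_eq_mul,
      mul_one, kernelMoment_zero_right, zero_add, pow_one] at this
    rw [integral_mul_const] at this
    rw [laguerreZ, this]
    field_simp
  have hZ' : laguerreZ N = C * (N.factorial * (1 / (N : ℝ)) ^ (N - 1)) / N := by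
    field_simp at hZ ⊢
    exact hZ
  rw [laguerreMoment, laguerreTraceMean, key m, hZ', pow_succ]
  have := Nat.factorial_ne_zero N
  field_simp

/-! ### The genus expansion of the moments. -/

/-- The coefficient of `N^{1-2g}` in the `m`-th moment, by the Haagerup–Thorbjørnsen recursion. -/
noncomputable def momentCoeff : ℕ → ℕ → ℝ
  | 0, 0 => 1
  | 0, 1 => 1
  | 0, p + 2 => (4 * p + 6) * momentCoeff 0 (p + 1) / (p + 3)
  | _ + 1, 0 => 0
  | _ + 1, 1 => 0
  | g + 1, p + 2 =>
    ((4 * p + 6) * momentCoeff (g + 1) (p + 1) + (p + 1) ^ 2 * p * momentCoeff g p) / (p + 3)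

theorem momentCoeff_eq_zero {g m : ℕ} (h : m < 2 * g) : momentCoeff g m = 0 := by
  induction m using Nat.strong_induction_on generalizing g with
  | _ m ih =>
    match g, m with
    | 0, _ => omega
    | g + 1, 0 => rw [momentCoeff]
    | g + 1, 1 => rw [momentCoeff]
    | g + 1, p + 2 =>
      rw [momentCoeff, ih (p + 1) (by omega) (by omega), ih p (by omega) (by omega)]
      simp

theorem laguerreMoment_recursion (N p : ℕ) (hN : 1 ≤ N) :
    ((p : ℝ) + 3) * laguerreMoment N (p + 2) = (4 * p + 6) * laguerreMoment N (p + 1) +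
      (N : ℝ) ^ (-2 : ℤ) * ((p + 1) ^ 2 * p * laguerreMoment N p) := by
  obtain ⟨n, rfl⟩ : ∃ n, N = n + 1 := ⟨N - 1, by omega⟩
  rw [laguerreMoment_eq _ _ hN, laguerreMoment_eq _ _ hN, laguerreMoment_eq _ _ hN]
  have h := kernelMoment_recursion n p
  have hn : ((n + 1 : ℕ) : ℝ) ≠ 0 := by positivity
  have hc : (n : ℝ) + 1 = ((n + 1 : ℕ) : ℝ) := by push_cast; ring
  rw [hc] at h
  generalize ((n + 1 : ℕ) : ℝ) = x at *
  have h2 : x ^ (-2 : ℤ) = 1 / x ^ 2 := by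
    rw [zpow_neg, one_div]; rfl
  rw [h2, pow_add, pow_succ]
  field_simp
  linear_combination x ^ p * x * h

/-- The cutoff `K` is kept free because the recursion calls the moment two steps down with one genus
fewer. -/
theorem laguerreMoment_eq_sum (N m K : ℕ) (hN : 1 ≤ N) (hK : m < 2 * K) :
    laguerreMoment N m =
      ∑ g ∈ Finset.range K, (N : ℝ) ^ (1 - 2 * (g : ℤ)) * momentCoeff g m := by
  have hN' : (N : ℝ) ≠ 0 := by positivity
  induction m using Nat.strong_induction_on generalizing K with
  | _ m ih =>
    obtain ⟨K, rfl⟩ : ∃ k, K = k + 1 := ⟨K - 1, by omega⟩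
    match m with
    | 0 =>
      rw [Finset.sum_range_succ', laguerreMoment_eq _ _ hN, kernelMoment_zero_right]
      simp [momentCoeff]
    | 1 =>
      obtain ⟨n, rfl⟩ : ∃ n, N = n + 1 := ⟨N - 1, by omega⟩
      rw [Finset.sum_range_succ', laguerreMoment_eq _ _ hN, kernelMoment_one_right]
      push_cast at hN' ⊢
      simp [momentCoeff]
      field_simp
    | p + 2 =>
      have h := laguerreMoment_recursion N p hN
      rw [ih (p + 1) (by omega) (K + 1) (by omega), ih p (by omega) K (by omega)] at h
      have h3 : ((p : ℝ) + 3) ≠ 0 := by positivity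
      apply mul_left_cancel₀ h3
      rw [h, Finset.sum_range_succ', Finset.sum_range_succ']
      have e0 : momentCoeff 0 (p + 2) = (4 * p + 6) * momentCoeff 0 (p + 1) / (p + 3) := by
        rw [momentCoeff]
      have e1 : ∀ g, momentCoeff (g + 1) (p + 2) = ((4 * p + 6) * momentCoeff (g + 1) (p + 1) +
          (p + 1) ^ 2 * p * momentCoeff g p) / (p + 3) := by
        intro g; rw [momentCoeff]
      rw [e0, mul_add, mul_add, add_right_comm, Finset.mul_sum, Finset.mul_sum, Finset.mul_sum,
        Finset.mul_sum, ← Finset.sum_add_distrib]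
      congr 1
      · refine Finset.sum_congr rfl fun g _ => ?_
        rw [e1]
        have : (N : ℝ) ^ (1 - 2 * ((g : ℕ) : ℤ)) =
            (N : ℝ) ^ (1 - 2 * ((g + 1 : ℕ) : ℤ)) * (N : ℝ) ^ (2 : ℤ) := by
          rw [← zpow_add₀ hN']; congr 1; push_cast; ring
        rw [this]
        have h2 : (N : ℝ) ^ (-2 : ℤ) = ((N : ℝ) ^ (2 : ℤ))⁻¹ := zpow_neg _ _
        have h4 : (N : ℝ) ^ (2 : ℤ) ≠ 0 := zpow_ne_zero _ hN'
        rw [h2]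
        field_simp
      · field_simp

theorem genusCoeff_eq_momentCoeff (m g : ℕ) : genusCoeff m g = momentCoeff g m := by
  induction g using Nat.strong_induction_on with
  | _ g ih =>
    rw [genusCoeff]
    apply Tendsto.limUnder_eq
    -- Once the lower genera are subtracted, a finite polynomial in `N^{-2}` is left, whose constant
    -- term is the limit.
    have hf : ∀ᶠ N : ℕ in atTop, ∑ h ∈ Finset.range (m + 1),
        (N : ℝ) ^ (-(2 * (h : ℤ))) * momentCoeff (g + h) m =
        (N : ℝ) ^ (2 * (g : ℤ) - 1) * (laguerreMoment N m -
          ∑ h : Fin g, (N : ℝ) ^ (1 - 2 * ((h : ℕ) : ℤ)) * genusCoeff m h) := by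
      filter_upwards [eventually_ge_atTop 1] with N hN
      have hN' : (N : ℝ) ≠ 0 := by positivity
      have hs : ∑ h ∈ Finset.range g, (N : ℝ) ^ (1 - 2 * (h : ℤ)) * genusCoeff m h =
          ∑ h ∈ Finset.range g, (N : ℝ) ^ (1 - 2 * (h : ℤ)) * momentCoeff h m :=
        Finset.sum_congr rfl fun h hh => by rw [ih h (Finset.mem_range.mp hh)]
      rw [Fin.sum_univ_eq_sum_range (fun h => (N : ℝ) ^ (1 - 2 * (h : ℤ)) * genusCoeff m h), hs,
        laguerreMoment_eq_sum N m (g + (m + 1)) hN (by omega), Finset.sum_range_add _ g (m + 1),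
        add_sub_cancel_left, Finset.mul_sum]
      refine Finset.sum_congr rfl fun h _ => ?_
      rw [← mul_assoc, ← zpow_add₀ hN']
      congr 2
      push_cast
      ring
    refine Tendsto.congr' hf ?_
    have : momentCoeff g m = ∑ h ∈ Finset.range (m + 1),
        (if h = 0 then 1 else 0) * momentCoeff (g + h) m := by
      simp
    rw [this]
    refine tendsto_finsetSum _ fun h _ => Tendsto.mul_const _ ?_
    split_ifs with h0
    · subst h0; simp
    · have : Tendsto (fun N : ℕ => ((N : ℝ) ^ (2 * h))⁻¹) atTop (𝓝 0) :=
        ((tendsto_pow_atTop (by omega)).comp tendsto_natCast_atTop_atTop).inv_tendsto_atTop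
      refine this.congr fun N => ?_
      rw [zpow_neg]
      norm_cast

/-! ### The five-term operator, its skew symmetry, and solvability at `k = 0`. -/

/-- The five-term operator on the right-hand side of the recursion for the coefficients. -/
noncomputable def fiveTerm (a : ℤ → ℝ) (k : ℤ) : ℝ :=
  (2 * (k : ℝ) + 7) * (2 * k + 5) * (2 * k + 3) / 32 * a (k + 3)
    - (2 * (k : ℝ) + 5) * (2 * k + 3) * (k + 1) / 4 * a (k + 2)
    + 3 * (2 * (k : ℝ) + 3) * (2 * k + 1) ^ 2 / 16 * a (k + 1)
    - (2 * (k : ℝ) + 1) * k * (2 * k - 1) / 4 * a k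
    + (2 * (k : ℝ) - 1) ^ 2 * (2 * k - 3) / 32 * a (k - 1)

/-- The transpose of `fiveTerm`. -/
noncomputable def fiveTermTranspose (f : ℤ → ℝ) (k : ℤ) : ℝ :=
  (2 * (k : ℝ) + 1) * (2 * k - 1) * (2 * k - 3) / 32 * f (k - 3)
    - (2 * (k : ℝ) + 1) * (2 * k - 1) * (k - 1) / 4 * f (k - 2)
    + 3 * (2 * (k : ℝ) + 1) * (2 * k - 1) ^ 2 / 16 * f (k - 1)
    - (2 * (k : ℝ) + 1) * k * (2 * k - 1) / 4 * f k
    + (2 * (k : ℝ) + 1) ^ 2 * (2 * k - 1) / 32 * f (k + 1)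

theorem tsum_fiveTerm_mul {a : ℤ → ℝ} (ha : (Function.support a).Finite) (f : ℤ → ℝ) :
    ∑' k, fiveTerm a k * f k = ∑' k, a k * fiveTermTranspose f k := by
  have hs : ∀ (s : ℤ) (d : ℤ → ℝ),
      HasSum (fun k => a (k + s) * d (k + s)) (∑' k, a k * d k) := by
    intro s d
    have h : Summable fun k => a k * d k :=
      summable_of_hasFiniteSupport (ha.subset (Function.support_mul_subset_left _ _))
    exact (Equiv.addRight s).hasSum_iff.mpr h.hasSum
  have hs0 : ∀ (d : ℤ → ℝ), HasSum (fun k => a k * d k) (∑' k, a k * d k) := by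
    intro d; simpa using hs 0 d
  have h3 := hs 3 fun k => (2 * (k : ℝ) + 1) * (2 * k - 1) * (2 * k - 3) / 32 * f (k - 3)
  have h2 := hs 2 fun k => (2 * (k : ℝ) + 1) * (2 * k - 1) * (k - 1) / 4 * f (k - 2)
  have h1 := hs 1 fun k => 3 * (2 * (k : ℝ) + 1) * (2 * k - 1) ^ 2 / 16 * f (k - 1)
  have h0 := hs0 fun k => (2 * (k : ℝ) + 1) * k * (2 * k - 1) / 4 * f k
  have hm := hs (-1) fun k => (2 * (k : ℝ) + 1) ^ 2 * (2 * k - 1) / 32 * f (k + 1)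
  have g3 := hs0 fun k => (2 * (k : ℝ) + 1) * (2 * k - 1) * (2 * k - 3) / 32 * f (k - 3)
  have g2 := hs0 fun k => (2 * (k : ℝ) + 1) * (2 * k - 1) * (k - 1) / 4 * f (k - 2)
  have g1 := hs0 fun k => 3 * (2 * (k : ℝ) + 1) * (2 * k - 1) ^ 2 / 16 * f (k - 1)
  have gm := hs0 fun k => (2 * (k : ℝ) + 1) ^ 2 * (2 * k - 1) / 32 * f (k + 1)
  have L := (((h3.sub h2).add h1).sub h0).add hm
  have R := (((g3.sub g2).add g1).sub h0).add gm
  refine Eq.trans (Eq.trans (tsum_congr fun k => ?_) L.tsum_eq)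
    (Eq.trans (tsum_congr fun k => ?_) R.tsum_eq).symm
  · simp only [fiveTerm, add_sub_cancel_right, ← sub_eq_add_neg,
      sub_add_cancel]
    push_cast
    ring
  · simp only [fiveTermTranspose]
    ring

/-- The invariant bilinear form `∑ (4k²-1) a_k b_{-k}`. -/
noncomputable def reflectionForm (a b : ℤ → ℝ) : ℝ :=
  ∑' k : ℤ, a k * ((4 * (k : ℝ) ^ 2 - 1) * b (-k))

theorem reflectionForm_comm (a b : ℤ → ℝ) : reflectionForm a b = reflectionForm b a := by
  rw [reflectionForm, ← (Equiv.neg ℤ).tsum_eq]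
  refine tsum_congr fun k => ?_
  simp only [Equiv.neg_apply, neg_neg]
  push_cast
  ring

/-- The weight `4k²-1 = (2k+1)(2k-1)` is chosen so that reflecting `k` carries the transpose of the
five-term operator to its negative. -/
theorem reflectionForm_fiveTerm_left {a : ℤ → ℝ} (ha : (Function.support a).Finite) (b : ℤ → ℝ) :
    reflectionForm (fiveTerm a) b = -reflectionForm a (fiveTerm b) := by
  rw [reflectionForm, tsum_fiveTerm_mul ha, reflectionForm, ← tsum_neg]
  refine tsum_congr fun k => ?_
  simp only [fiveTerm, fiveTermTranspose, neg_sub, neg_add_rev]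
  rw [show -k + 3 = 3 - k by ring, show -k + 2 = 2 - k by ring, show -k + 1 = 1 - k by ring,
    show -1 + -k = -k - 1 by ring]
  push_cast
  ring

theorem reflectionForm_index_left (a b : ℤ → ℝ) :
    reflectionForm (fun k => 4 * k * a k) b = -reflectionForm a fun k => 4 * k * b k := by
  rw [reflectionForm, reflectionForm, ← tsum_neg]
  refine tsum_congr fun k => ?_
  push_cast
  ring

/-- The solution of the recursion. -/
noncomputable def vCoeff : ℕ → ℤ → ℝ
  | 0, k => if k = 0 then -1 / 2 else 0
  | g + 1, k =>
    if k = 0 then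
      -∑ j ∈ (Finset.Icc (-3 * ((g + 1 : ℕ) : ℤ)) ((g + 1 : ℕ) : ℤ)).erase 0,
        fiveTerm (vCoeff g) j / (4 * j)
    else fiveTerm (vCoeff g) k / (4 * k)

theorem vCoeff_zero (k : ℤ) : vCoeff 0 k = if k = 0 then -1 / 2 else 0 := by
  rw [vCoeff]

theorem vCoeff_succ_of_ne {k : ℤ} (hk : k ≠ 0) (g : ℕ) :
    vCoeff (g + 1) k = fiveTerm (vCoeff g) k / (4 * k) := by
  rw [vCoeff, if_neg hk]

theorem fiveTerm_eq_zero {a : ℤ → ℝ} {g : ℕ}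
    (ha : ∀ k : ℤ, k < -3 * (g : ℤ) ∨ (g : ℤ) < k → a k = 0) {k : ℤ}
    (hk : k < -3 * ((g + 1 : ℕ) : ℤ) ∨ ((g + 1 : ℕ) : ℤ) < k) : fiveTerm a k = 0 := by
  push_cast at hk
  rw [fiveTerm, ha (k + 3) (by omega), ha (k + 2) (by omega), ha (k + 1) (by omega),
    ha k (by omega), ha (k - 1) (by omega)]
  ring

theorem genusSupported_vCoeff : GenusSupported vCoeff := by
  intro g
  induction g with
  | zero =>
    intro k hk
    rw [vCoeff_zero, if_neg (by push_cast at hk; omega)]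
  | succ g ih =>
    intro k hk
    rw [vCoeff_succ_of_ne (by push_cast at hk; omega), fiveTerm_eq_zero ih hk, zero_div]

theorem GenusSupported.finite_support {a : ℕ → ℤ → ℝ} (ha : GenusSupported a) (g : ℕ) :
    (Function.support (a g)).Finite := by
  refine (Set.finite_Icc (-3 * (g : ℤ)) (g : ℤ)).subset fun k hk => ?_
  by_contra h
  rw [Set.mem_Icc] at h
  exact hk (ha g k (by omega))

theorem GenusSupported.tsum_mul_eq {a : ℕ → ℤ → ℝ} (ha : GenusSupported a) (g : ℕ) (f : ℤ → ℝ) :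
    ∑' k, a g k * f k = ∑ k ∈ Finset.Icc (-3 * (g : ℤ)) (g : ℤ), a g k * f k := by
  refine tsum_eq_sum fun k hk => ?_
  rw [Finset.mem_Icc] at hk
  rw [ha g k (by omega), zero_mul]

theorem sum_vCoeff_succ (g : ℕ) :
    ∑ k ∈ Finset.Icc (-3 * ((g + 1 : ℕ) : ℤ)) ((g + 1 : ℕ) : ℤ), vCoeff (g + 1) k = 0 := by
  have h0 : (0 : ℤ) ∈ Finset.Icc (-3 * ((g + 1 : ℕ) : ℤ)) ((g + 1 : ℕ) : ℤ) := by
    rw [Finset.mem_Icc]; omega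
  rw [← Finset.add_sum_erase _ _ h0, vCoeff, if_pos rfl, neg_add_eq_zero]
  exact Finset.sum_congr rfl fun k hk => (vCoeff_succ_of_ne (Finset.ne_of_mem_erase hk) g).symm

/-- The recursion is solvable at `k = 0`. -/
theorem fiveTerm_vCoeff_zero (g : ℕ) : fiveTerm (vCoeff g) 0 = 0 := by
  induction g using Nat.strong_induction_on with
  | _ G ih =>
    -- With `T` the five-term operator and `D` multiplication by `4k`, this is `D a_{g+1} = T a_g`;
    -- at `k = 0` it is exactly the induction hypothesis.
    have hD : ∀ g < G, (fun k : ℤ => 4 * (k : ℝ) * vCoeff (g + 1) k) = fiveTerm (vCoeff g) := by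
      intro g hg
      ext k
      by_cases hk : k = 0
      · rw [hk, ih g hg]; simp
      · have : (k : ℝ) ≠ 0 := by exact_mod_cast hk
        rw [vCoeff_succ_of_ne hk]
        field_simp
    have hfin := genusSupported_vCoeff.finite_support
    -- Both `T` and `D` are skew, so `B(T a_{j+1}, a_i) = -B(a_{j+1}, D a_{i+1}) = B(D a_{j+1},
    -- a_{i+1}) = B(T a_j, a_{i+1})`: only `i + j` matters.
    have hX : ∀ i j, i + j = G → reflectionForm (fiveTerm (vCoeff j)) (vCoeff i) =
        reflectionForm (fiveTerm (vCoeff G)) (vCoeff 0) := by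
      intro i
      induction i with
      | zero => intro j hj; rw [zero_add] at hj; rw [hj]
      | succ i ihi =>
        intro j hj
        rw [← ihi (j + 1) (by omega), reflectionForm_fiveTerm_left (hfin (j + 1)),
          ← hD i (by omega), ← hD j (by omega), reflectionForm_index_left]
    have h1 := hX G 0 rfl
    -- The two extreme values are equal, but skewness and symmetry make them opposite, so both
    -- vanish. Pairing with `a_0` reads off the entry at `k = 0`.
    rw [reflectionForm_fiveTerm_left (hfin 0), reflectionForm_comm] at h1
    have h2 : reflectionForm (fiveTerm (vCoeff G)) (vCoeff 0) = fiveTerm (vCoeff G) 0 / 2 := by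
      rw [reflectionForm, tsum_eq_single 0]
      · simp [vCoeff_zero]; ring
      · intro k hk
        simp [vCoeff_zero, hk]
    linarith

theorem index_mul_vCoeff_succ (g : ℕ) (k : ℤ) :
    4 * (k : ℝ) * vCoeff (g + 1) k = fiveTerm (vCoeff g) k := by
  by_cases hk : k = 0
  · rw [hk, fiveTerm_vCoeff_zero]; simp
  · have : (k : ℝ) ≠ 0 := by exact_mod_cast hk
    rw [vCoeff_succ_of_ne hk]
    field_simp

theorem satisfiesVRecursion_iff (b : ℕ → ℤ → ℝ) : SatisfiesVRecursion b ↔ b = vCoeff := by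
  constructor
  · rintro ⟨hsupp, h0, hrec, hsum⟩
    ext g k
    induction g generalizing k with
    | zero => rw [h0, vCoeff_zero]
    | succ g ih =>
      have hb : b g = vCoeff g := funext ih
      have hne : ∀ k : ℤ, k ≠ 0 → b (g + 1) k = vCoeff (g + 1) k := by
        intro k hk
        have hk' : 4 * (k : ℝ) ≠ 0 := by
          have : (k : ℝ) ≠ 0 := by exact_mod_cast hk
          positivity
        apply mul_left_cancel₀ hk'
        rw [hrec (g + 1) k g.succ_pos hk, index_mul_vCoeff_succ, Nat.add_sub_cancel, hb, fiveTerm]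
      by_cases hk : k = 0
      · subst hk
        have h1 := hsum (g + 1) g.succ_pos
        have h2 := sum_vCoeff_succ g
        have h0 : (0 : ℤ) ∈ Finset.Icc (-3 * ((g + 1 : ℕ) : ℤ)) ((g + 1 : ℕ) : ℤ) := by
          rw [Finset.mem_Icc]; omega
        rw [← Finset.add_sum_erase _ _ h0] at h1 h2
        rw [Finset.sum_congr rfl fun k hk => hne k (Finset.ne_of_mem_erase hk)] at h1
        linarith
      · exact hne k hk
  · rintro rfl
    refine ⟨genusSupported_vCoeff, vCoeff_zero, ?_, ?_⟩
    · intro g k hg _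
      obtain ⟨g, rfl⟩ : ∃ h, g = h + 1 := ⟨g - 1, by omega⟩
      rw [index_mul_vCoeff_succ, Nat.add_sub_cancel, fiveTerm]
    · intro g hg
      obtain ⟨g, rfl⟩ : ∃ h, g = h + 1 := ⟨g - 1, by omega⟩
      exact sum_vCoeff_succ g

/-! ### Taylor coefficients of `(1-4z)^{k+1/2}` and the match with the moments. -/

/-- The coefficient of `z^m` in `(1-4z)^{k+1/2}`. -/
noncomputable def halfBinomCoeff (m : ℕ) (k : ℤ) : ℝ :=
  (-4) ^ m * Ring.choose ((k : ℝ) + 1 / 2) m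

theorem Ring.succ_mul_choose_succ (r : ℝ) (m : ℕ) :
    ((m : ℝ) + 1) * Ring.choose r (m + 1) = (r - m) * Ring.choose r m := by
  rw [Ring.choose_eq_smul, Ring.choose_eq_smul, descPochhammer_succ_right, Polynomial.smeval_mul,
    Nat.factorial_succ]
  simp [Polynomial.smeval_natCast]
  field_simp

theorem halfBinomCoeff_zero (k : ℤ) : halfBinomCoeff 0 k = 1 := by
  simp [halfBinomCoeff]

theorem halfBinomCoeff_succ (m : ℕ) (k : ℤ) :
    ((m : ℝ) + 1) * halfBinomCoeff (m + 1) k = (4 * m - 4 * k - 2) * halfBinomCoeff m k := by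
  have := Ring.succ_mul_choose_succ ((k : ℝ) + 1 / 2) m
  rw [halfBinomCoeff, halfBinomCoeff, pow_succ]
  linear_combination (-4) * (-4) ^ m * this

/-- This trades a factor `m`, that is the Euler operator `z d/dz`, for a lowering of `k`. -/
theorem halfBinomCoeff_sub_one (m : ℕ) (k : ℤ) :
    ((k : ℝ) + 1 / 2 - m) * halfBinomCoeff m k = ((k : ℝ) + 1 / 2) * halfBinomCoeff m (k - 1) := by
  induction m with
  | zero => simp [halfBinomCoeff_zero]
  | succ m ih =>
    have h1 := halfBinomCoeff_succ m k
    have h2 := halfBinomCoeff_succ m (k - 1)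
    have h : (m : ℝ) + 1 ≠ 0 := by positivity
    apply mul_left_cancel₀ h
    push_cast at *
    linear_combination ((k : ℝ) + 1 / 2 - (m + 1)) * h1 - ((k : ℝ) + 1 / 2) * h2
      - 4 * ((k : ℝ) + 1 / 2 - (m + 1)) * ih

/-- Coefficient form of `4z = 1 - (1-4z)`. -/
theorem four_mul_halfBinomCoeff (m : ℕ) (k : ℤ) :
    4 * halfBinomCoeff m k = halfBinomCoeff (m + 1) k - halfBinomCoeff (m + 1) (k + 1) := by
  have h1 := halfBinomCoeff_succ m k
  have h2 := halfBinomCoeff_succ m (k + 1)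
  have h3 := halfBinomCoeff_sub_one m (k + 1)
  rw [add_sub_cancel_right] at h3
  have h : (m : ℝ) + 1 ≠ 0 := by positivity
  apply mul_left_cancel₀ h
  push_cast at *
  linear_combination h2 - h1 - 4 * h3

theorem fiveTermTranspose_halfBinomCoeff_zero (k : ℤ) :
    fiveTermTranspose (halfBinomCoeff 0) k = 0 := by
  simp only [fiveTermTranspose, halfBinomCoeff_zero]
  ring

/-- Three Euler factors spread `k` down to `k-3`, and multiplication by `z` becomes a difference
reaching `k+1`; this is why there are five terms. -/
theorem fiveTermTranspose_halfBinomCoeff_succ (n : ℕ) (k : ℤ) :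
    fiveTermTranspose (halfBinomCoeff (n + 1)) k = -((n : ℝ) ^ 2 * (n - 1) * halfBinomCoeff n k) := by
  have e0 := halfBinomCoeff_sub_one n k
  have e1 := halfBinomCoeff_sub_one n (k - 1)
  have e2 := halfBinomCoeff_sub_one n (k - 2)
  have r0 := four_mul_halfBinomCoeff n k
  have r1 := four_mul_halfBinomCoeff n (k - 1)
  have r2 := four_mul_halfBinomCoeff n (k - 2)
  have r3 := four_mul_halfBinomCoeff n (k - 3)
  rw [show k - 1 - 1 = k - 2 by ring] at e1
  rw [show k - 2 - 1 = k - 3 by ring] at e2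
  rw [show k - 1 + 1 = k by ring] at r1
  rw [show k - 2 + 1 = k - 1 by ring] at r2
  rw [show k - 3 + 1 = k - 2 by ring] at r3
  simp only [fiveTermTranspose]
  push_cast at *
  have A : (n : ℝ) ^ 2 * (n - 1) * halfBinomCoeff n k =
      ((k : ℝ) + 1 / 2) ^ 2 * (k - 1 / 2) * halfBinomCoeff n k
      - ((k : ℝ) + 1 / 2) * (k - 1 / 2) * (3 * k - 1 / 2) * halfBinomCoeff n (k - 1)
      + ((k : ℝ) + 1 / 2) * (k - 1 / 2) * (3 * k - 5 / 2) * halfBinomCoeff n (k - 2)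
      - ((k : ℝ) + 1 / 2) * (k - 1 / 2) * (k - 3 / 2) * halfBinomCoeff n (k - 3) := by
    set s : ℝ := (k : ℝ) + 1 / 2
    linear_combination (-n * (n - 1) - s * (n - 1) - s ^ 2) * e0 +
      (s * (n - 1) + s * (2 * s - 1)) * e1 + (-s * (s - 1)) * e2
  rw [A]
  linear_combination
    ((k : ℝ) + 1 / 2) ^ 2 * (k - 1 / 2) / 4 * r0
      - ((k : ℝ) + 1 / 2) * (k - 1 / 2) * (3 * k - 1 / 2) / 4 * r1
      + ((k : ℝ) + 1 / 2) * (k - 1 / 2) * (3 * k - 5 / 2) / 4 * r2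
      - ((k : ℝ) + 1 / 2) * (k - 1 / 2) * (k - 3 / 2) / 4 * r3

/-- The coefficient of `z^m` in `∑ a_k (1-4z)^{k+1/2}` for the solution `a` of the recursion. -/
noncomputable def vSeriesCoeff (g m : ℕ) : ℝ :=
  ∑' k, vCoeff g k * halfBinomCoeff m k

theorem summable_vCoeff_mul (g : ℕ) (f : ℤ → ℝ) : Summable fun k => vCoeff g k * f k :=
  summable_of_hasFiniteSupport
    ((genusSupported_vCoeff.finite_support g).subset (Function.support_mul_subset_left _ _))

theorem vSeriesCoeff_succ (g m : ℕ) :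
    ((m : ℝ) + 1) * vSeriesCoeff g (m + 1) = (4 * m - 2) * vSeriesCoeff g m -
      ∑' k : ℤ, 4 * (k : ℝ) * vCoeff g k * halfBinomCoeff m k := by
  have h : ∀ k : ℤ, 4 * (k : ℝ) * vCoeff g k * halfBinomCoeff m k =
      vCoeff g k * (4 * k * halfBinomCoeff m k) := fun k => by ring
  simp_rw [h, vSeriesCoeff, ← tsum_mul_left]
  rw [← Summable.tsum_sub ((summable_vCoeff_mul g _).mul_left _) (summable_vCoeff_mul g _)]
  refine tsum_congr fun k => ?_
  linear_combination vCoeff g k * halfBinomCoeff_succ m k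

theorem vSeriesCoeff_zero_succ (m : ℕ) :
    ((m : ℝ) + 1) * vSeriesCoeff 0 (m + 1) = (4 * m - 2) * vSeriesCoeff 0 m := by
  have h : ∀ k : ℤ, 4 * (k : ℝ) * vCoeff 0 k * halfBinomCoeff m k = 0 := by
    intro k
    by_cases hk : k = 0 <;> simp [vCoeff_zero, hk]
  rw [vSeriesCoeff_succ]
  simp [h]

theorem vSeriesCoeff_succ_succ (g m : ℕ) :
    ((m : ℝ) + 1) * vSeriesCoeff (g + 1) (m + 1) = (4 * m - 2) * vSeriesCoeff (g + 1) m -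
      ∑' k, vCoeff g k * fiveTermTranspose (halfBinomCoeff m) k := by
  rw [vSeriesCoeff_succ, ← tsum_fiveTerm_mul (genusSupported_vCoeff.finite_support g)]
  simp_rw [index_mul_vCoeff_succ]

theorem vSeriesCoeff_succ_succ_succ (g n : ℕ) :
    ((n : ℝ) + 2) * vSeriesCoeff (g + 1) (n + 2) = (4 * n + 2) * vSeriesCoeff (g + 1) (n + 1) +
      (n : ℝ) ^ 2 * (n - 1) * vSeriesCoeff g n := by
  have h := vSeriesCoeff_succ_succ g (n + 1)
  have h2 : ∑' k, vCoeff g k * fiveTermTranspose (halfBinomCoeff (n + 1)) k =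
      -((n : ℝ) ^ 2 * (n - 1) * vSeriesCoeff g n) := by
    rw [vSeriesCoeff, ← tsum_mul_left, ← tsum_neg]
    refine tsum_congr fun k => ?_
    rw [fiveTermTranspose_halfBinomCoeff_succ]
    ring
  rw [h2] at h
  push_cast at h
  linear_combination h

/-- Every `(1-4z)^{k+1/2}` equals `1` at `z = 0`, so the sum condition says that the constant term
vanishes in positive genus. -/
theorem vSeriesCoeff_right_zero (g : ℕ) : vSeriesCoeff g 0 = if g = 0 then -1 / 2 else 0 := by
  rw [vSeriesCoeff, genusSupported_vCoeff.tsum_mul_eq]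
  simp only [halfBinomCoeff_zero, mul_one]
  cases g with
  | zero => simp [vCoeff_zero]
  | succ g => rw [sum_vCoeff_succ]; simp

theorem momentCoeff_eq_vSeriesCoeff (g m : ℕ) : momentCoeff g m = vSeriesCoeff g (m + 1) := by
  induction m using Nat.strong_induction_on generalizing g with
  | _ m ih =>
    match g, m with
    | 0, 0 =>
      have h := vSeriesCoeff_zero_succ 0
      rw [vSeriesCoeff_right_zero] at h
      rw [momentCoeff]
      simp at h ⊢
      linarith
    | 0, 1 =>
      have h := vSeriesCoeff_zero_succ 1
      have h0 : vSeriesCoeff 0 1 = 1 := by rw [← ih 0 (by omega) 0, momentCoeff]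
      rw [h0] at h
      rw [momentCoeff]
      norm_num at h ⊢
      linarith
    | 0, p + 2 =>
      have h := vSeriesCoeff_zero_succ (p + 2)
      rw [momentCoeff, ih (p + 1) (by omega) 0, div_eq_iff (by positivity)]
      push_cast at h
      linear_combination -h
    | g + 1, 0 =>
      have h := vSeriesCoeff_succ_succ g 0
      rw [vSeriesCoeff_right_zero] at h
      rw [momentCoeff]
      simp [fiveTermTranspose_halfBinomCoeff_zero] at h
      exact h.symm
    | g + 1, 1 =>
      have h := vSeriesCoeff_succ_succ_succ g 0
      have h0 : vSeriesCoeff (g + 1) (0 + 1) = 0 := by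
        rw [← ih 0 (by omega) (g + 1), momentCoeff]
      rw [h0] at h
      rw [momentCoeff]
      simp at h ⊢
      exact h.symm
    | g + 1, p + 2 =>
      have h := vSeriesCoeff_succ_succ_succ g (p + 1)
      rw [momentCoeff, ih (p + 1) (by omega) (g + 1), ih p (by omega) g,
        div_eq_iff (by positivity)]
      push_cast at h
      linear_combination -h

/-! ### Summation of the series and the change of variables. -/

theorem hasSum_halfBinomCoeff {x : ℂ} (hx : 4 < ‖x‖) (k : ℤ) :
    HasSum (fun m => (halfBinomCoeff m k : ℂ) / x ^ m)
      ((1 - 4 / x) ^ ((k : ℂ) + 1 / 2)) := by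
  have hz : ‖-4 / x‖ < 1 := by
    rw [norm_div, div_lt_one (by linarith)]
    simpa using hx
  have h := (Complex.one_add_cpow_hasFPowerSeriesOnBall_zero (a := (k : ℂ) + 1 / 2)).hasSum
    (y := -4 / x) (by simpa [← ofReal_norm] using hz)
  rw [zero_add, neg_div, ← sub_eq_add_neg, ← neg_div] at h
  convert! h using 2 with m
  rw [binomialSeries_apply, halfBinomCoeff]
  push_cast [Complex.ofReal_choose]
  simp [List.ofFn_const, div_pow]
  ring

theorem hasSum_vSeriesCoeff (g : ℕ) {x : ℂ} (hx : 4 < ‖x‖) :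
    HasSum (fun m => (vSeriesCoeff g m : ℂ) / x ^ m)
      (∑ k ∈ Finset.Icc (-3 * (g : ℤ)) (g : ℤ),
        (vCoeff g k : ℂ) * (1 - 4 / x) ^ ((k : ℂ) + 1 / 2)) := by
  convert! hasSum_sum fun k (_ : k ∈ Finset.Icc (-3 * (g : ℤ)) (g : ℤ)) =>
    (hasSum_halfBinomCoeff hx k).mul_left (vCoeff g k : ℂ) using 2 with m
  rw [vSeriesCoeff, genusSupported_vCoeff.tsum_mul_eq]
  push_cast
  rw [Finset.sum_div]
  exact Finset.sum_congr rfl fun k _ => by ring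

theorem hasSum_genusMeanTerm (g : ℕ) {x : ℂ} (hx : 4 < ‖x‖) :
    HasSum (genusMeanTerm g x) ((if g = 0 then 1 / 2 else 0) +
      ∑ k ∈ Finset.Icc (-3 * (g : ℤ)) (g : ℤ),
        (vCoeff g k : ℂ) * (1 - 4 / x) ^ ((k : ℂ) + 1 / 2)) := by
  -- The moments start at `x^{-1}`. Dropping the constant term, which is `-1/2` in genus zero,
  -- produces the additional `1/2`.
  have h := (hasSum_nat_add_iff' 1).mpr (hasSum_vSeriesCoeff g hx)
  convert! h using 1
  · ext m
    rw [genusMeanTerm, genusCoeff_eq_momentCoeff, momentCoeff_eq_vSeriesCoeff]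
  · simp [vSeriesCoeff_right_zero]
    split_ifs <;> simp
    ring

/-- The uniformising coordinate `(e^l - 1) / (e^l + 1)` has positive real part for `Re l > 0`. -/
theorem re_exp_sub_one_div_exp_add_one_pos {l : ℂ} (hl : 0 < l.re) :
    0 < ((Complex.exp l - 1) / (Complex.exp l + 1)).re := by
  have hn : 1 < Complex.normSq (Complex.exp l) := by
    rw [Complex.normSq_eq_norm_sq, Complex.norm_exp]
    exact one_lt_pow₀ (by simpa using hl) two_ne_zero
  have h1 : Complex.exp l + 1 ≠ 0 := by
    intro h
    rw [eq_neg_of_add_eq_zero_left h] at hn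
    simp at hn
  have hp : 0 < Complex.normSq (Complex.exp l + 1) := Complex.normSq_pos.mpr h1
  rw [Complex.div_re, ← add_div]
  refine div_pos ?_ hp
  rw [Complex.normSq_apply] at hn
  simp only [Complex.sub_re, Complex.add_re, Complex.one_re, Complex.sub_im, Complex.add_im,
    Complex.one_im]
  linarith

theorem one_sub_four_div_spectralX {l : ℂ} (hl : 0 < l.re) :
    1 - 4 / spectralX l = ((Complex.exp l - 1) / (Complex.exp l + 1)) ^ 2 := by
  have hn : 1 < Complex.normSq (Complex.exp l) := by
    rw [Complex.normSq_eq_norm_sq, Complex.norm_exp]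
    exact one_lt_pow₀ (by simpa using hl) two_ne_zero
  have h1 : Complex.exp l + 1 ≠ 0 := by
    intro h
    rw [eq_neg_of_add_eq_zero_left h] at hn
    simp at hn
  have h0 := Complex.exp_ne_zero l
  have hx : spectralX l = (Complex.exp l + 1) ^ 2 / Complex.exp l := by
    rw [spectralX, Complex.exp_neg]
    field_simp
    ring
  rw [hx]
  field_simp
  ring

/-- The condition `Re l > 0` selects the branch: with `Re w > 0`, the principal square root of `w²`
is `w`. -/
theorem one_sub_four_div_spectralX_cpow {l : ℂ} (hl : 0 < l.re) (k : ℤ) :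
    (1 - 4 / spectralX l) ^ ((k : ℂ) + 1 / 2) = vFun k l := by
  have hw := re_exp_sub_one_div_exp_add_one_pos hl
  rw [one_sub_four_div_spectralX hl, vFun]
  set w := (Complex.exp l - 1) / (Complex.exp l + 1)
  have hw0 : w ≠ 0 := by
    intro h; rw [h] at hw; simp at hw
  rw [Complex.cpow_add _ _ (pow_ne_zero 2 hw0), Complex.cpow_intCast, one_div,
    Complex.sq_cpow_two_inv hw, zpow_add_one₀ hw0, zpow_mul]
  rfl

theorem genusMean_spectralX (g : ℕ) {l : ℂ} (hl : 0 < l.re) (hx : 4 < ‖spectralX l‖) :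
    genusMean g (spectralX l) = (if g = 0 then 1 / 2 else 0) +
      ∑ k ∈ Finset.Icc (-3 * (g : ℤ)) (g : ℤ), (vCoeff g k : ℂ) * vFun k l := by
  rw [genusMean, (hasSum_genusMeanTerm g hx).tsum_eq]
  simp_rw [one_sub_four_div_spectralX_cpow hl]

theorem four_lt_norm_spectralX_ofReal {l : ℝ} (hl : 0 < l) : 4 < ‖spectralX (l : ℂ)‖ := by
  have h : spectralX (l : ℂ) = ((Real.exp l + Real.exp (-l) + 2 : ℝ) : ℂ) := by
    rw [spectralX]; push_cast; rfl
  have h1 : 1 < Real.exp l := Real.one_lt_exp_iff.mpr hl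
  have h2 : Real.exp l * Real.exp (-l) = 1 := by rw [← Real.exp_add]; simp
  have h3 := Real.exp_pos (-l)
  rw [h, Complex.norm_real, Real.norm_eq_abs, abs_of_pos (by positivity)]
  nlinarith [sq_nonneg (Real.exp l - Real.exp (-l)), sq_nonneg (Real.exp l - 1)]

theorem tendsto_vFun (k : ℤ) : Tendsto (fun l : ℝ => vFun k l) atTop (𝓝 1) := by
  have h0 : Tendsto (fun l : ℝ => (Real.exp l)⁻¹) atTop (𝓝 0) :=
    Real.tendsto_exp_atTop.inv_tendsto_atTop
  have h1 : Tendsto (fun l : ℝ => (((Real.exp l)⁻¹ : ℝ) : ℂ)) atTop (𝓝 0) := by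
    exact (Complex.continuous_ofReal.tendsto 0).comp h0
  have h2 : Tendsto (fun l : ℝ => (1 - (((Real.exp l)⁻¹ : ℝ) : ℂ)) /
      (1 + (((Real.exp l)⁻¹ : ℝ) : ℂ))) atTop (𝓝 1) := by
    have := (h1.const_sub 1).div (h1.const_add 1) (by simp)
    rwa [sub_zero, add_zero, div_one] at this
  have h3 : Tendsto (fun l : ℝ => ((1 - (((Real.exp l)⁻¹ : ℝ) : ℂ)) /
      (1 + (((Real.exp l)⁻¹ : ℝ) : ℂ))) ^ (2 * k + 1)) atTop (𝓝 1) := by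
    simpa using h2.zpow₀ (2 * k + 1) (Or.inl one_ne_zero)
  refine h3.congr fun l => ?_
  rw [vFun]
  congr 1
  have he : (Complex.exp l) ≠ 0 := Complex.exp_ne_zero _
  push_cast
  rw [← mul_div_mul_left _ _ he]
  congr 1 <;> field_simp

theorem tendsto_genusMean (g : ℕ) :
    Tendsto (fun l : ℝ => genusMean g (spectralX (l : ℂ))) atTop (𝓝 0) := by
  have h : Tendsto (fun l : ℝ => (if g = 0 then 1 / 2 else 0 : ℂ) +
      ∑ k ∈ Finset.Icc (-3 * (g : ℤ)) (g : ℤ), (vCoeff g k : ℂ) * vFun k l) atTop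
      (𝓝 ((if g = 0 then 1 / 2 else 0 : ℂ) +
      ∑ k ∈ Finset.Icc (-3 * (g : ℤ)) (g : ℤ), (vCoeff g k : ℂ) * 1)) :=
    (tendsto_finsetSum _ fun k _ => (tendsto_vFun k).const_mul _).const_add _
  have h0 : (if g = 0 then 1 / 2 else 0 : ℂ) +
      ∑ k ∈ Finset.Icc (-3 * (g : ℤ)) (g : ℤ), (vCoeff g k : ℂ) * 1 = 0 := by
    have := vSeriesCoeff_right_zero g
    rw [vSeriesCoeff, genusSupported_vCoeff.tsum_mul_eq] at this
    simp only [halfBinomCoeff_zero, mul_one] at this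
    simp only [mul_one]
    rw [← Complex.ofReal_sum, this]
    split_ifs <;> simp
    ring
  rw [h0] at h
  refine h.congr' ?_
  filter_upwards [eventually_gt_atTop 0] with l hl
  exact (genusMean_spectralX g (by simpa using hl) (four_lt_norm_spectralX_ofReal hl)).symm

/-! ### Uniqueness of the expansion. -/

theorem exists_vFun_eq {w : ℝ} (h0 : 0 < w) (h1 : w < 1) :
    ∃ l : ℝ, 0 < l ∧ ∀ k, vFun k l = ((w ^ (2 * k + 1) : ℝ) : ℂ) := by
  have hpos : 0 < (1 + w) / (1 - w) := div_pos (by linarith) (by linarith)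
  -- The inverse of `w = tanh(l/2)`.
  refine ⟨Real.log ((1 + w) / (1 - w)), Real.log_pos ?_, fun k => ?_⟩
  · rw [one_lt_div (by linarith)]; linarith
  · rw [vFun, ← Complex.ofReal_exp, Real.exp_log hpos]
    have : ((1 + w) / (1 - w) - 1) / ((1 + w) / (1 - w) + 1) = w := by
      have : 1 - w ≠ 0 := by linarith
      field_simp
      ring
    norm_cast
    rw [this]

/-- The functions `w^{2k+1}` are linearly independent on `(0,1)`. -/
theorem eq_zero_of_sum_zpow_eq_zero (n : ℕ) (d : ℤ → ℝ)
    (h : ∀ w : ℝ, 0 < w → w < 1 →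
      ∑ k ∈ Finset.Icc (-3 * (n : ℤ)) (n : ℤ), d k * w ^ (2 * k + 1) = 0)
    {k : ℤ} (hk : k ∈ Finset.Icc (-3 * (n : ℤ)) (n : ℤ)) : d k = 0 := by
  -- The lowest exponent is `1 - 6n`, so multiplying by `w^{6n}` gives a polynomial with distinct
  -- exponents.
  set q : Polynomial ℝ := ∑ k ∈ Finset.Icc (-3 * (n : ℤ)) (n : ℤ),
    Polynomial.monomial (2 * k + 1 + 6 * n).toNat (d k) with hq
  have hq0 : q = 0 := by
    refine Polynomial.eq_zero_of_infinite_isRoot q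
      ((Set.Ioo_infinite (zero_lt_one' ℝ)).mono fun w hw => ?_)
    have hw0 : w ≠ 0 := hw.1.ne'
    rw [Set.mem_ofPred_eq, Polynomial.IsRoot, hq, Polynomial.eval_finsetSum]
    have : w ^ (6 * (n : ℤ)) *
        ∑ k ∈ Finset.Icc (-3 * (n : ℤ)) (n : ℤ), d k * w ^ (2 * k + 1) = 0 := by
      rw [h w hw.1 hw.2, mul_zero]
    rw [← this, Finset.mul_sum]
    refine Finset.sum_congr rfl fun j hj => ?_
    rw [Finset.mem_Icc] at hj
    rw [Polynomial.eval_monomial, ← zpow_natCast, Int.toNat_of_nonneg (by omega),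
      zpow_add₀ hw0 (2 * j + 1)]
    ring
  have hc := congrArg (fun p => Polynomial.coeff p (2 * k + 1 + 6 * n).toNat) hq0
  simp only [hq, Polynomial.finsetSum_coeff, Polynomial.coeff_monomial,
    Polynomial.coeff_zero] at hc
  rw [Finset.sum_eq_single k] at hc
  · simpa using hc
  · intro j hj hjk
    rw [Finset.mem_Icc] at hj hk
    rw [if_neg (by omega)]
  · exact fun h => absurd hk h

theorem isVExpansion_iff (b : ℕ → ℤ → ℝ) : IsVExpansion b ↔ b = vCoeff := by
  constructor
  · rintro ⟨hsupp, hexp⟩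
    ext g k
    by_cases hk : k ∈ Finset.Icc (-3 * (g : ℤ)) (g : ℤ)
    · rw [← sub_eq_zero]
      refine eq_zero_of_sum_zpow_eq_zero g (fun k => b g k - vCoeff g k) (fun w h0 h1 => ?_) hk
      obtain ⟨l, hl, hv⟩ := exists_vFun_eq h0 h1
      have hre : 0 < (l : ℂ).re := by simpa using hl
      have hx := four_lt_norm_spectralX_ofReal hl
      have h := (hexp g l hre hx).symm.trans (genusMean_spectralX g hre hx)
      simp only [hv] at h
      have h := add_left_cancel h
      have h' : ∑ k ∈ Finset.Icc (-3 * (g : ℤ)) (g : ℤ), b g k * w ^ (2 * k + 1) =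
          ∑ k ∈ Finset.Icc (-3 * (g : ℤ)) (g : ℤ), vCoeff g k * w ^ (2 * k + 1) := by
        exact_mod_cast h
      simp only [sub_mul, Finset.sum_sub_distrib, h', sub_self]
    · rw [Finset.mem_Icc] at hk
      rw [hsupp g k (by omega), genusSupported_vCoeff g k (by omega)]
  · rintro rfl
    exact ⟨genusSupported_vCoeff, fun g l hl hx => genusMean_spectralX g hl hx⟩

theorem mainTheorem4 :
    -- the genus expansion of the one-loop mean, coefficient by coefficient in `1/x`
    (∀ N m : ℕ, 1 ≤ N →
      laguerreMoment N m =
        ∑ g ∈ Finset.range (m / 2 + 1), (N : ℝ) ^ (1 - 2 * (g : ℤ)) * genusCoeff m g) ∧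
    (∀ g m : ℕ, m < 2 * g → genusCoeff m g = 0) ∧
    -- each genus term is an honest function of `x` for `|x| > 4`
    (∀ (g : ℕ) (x : ℂ), 4 < ‖x‖ → Summable (genusMeanTerm g x)) ∧
    -- the asymptotic condition
    (∀ g : ℕ, Tendsto (fun l : ℝ => genusMean g (spectralX (l : ℂ))) atTop (𝓝 0)) ∧
    -- the coefficients of the expansion in the `v_k` exist, are unique, and are exactly the
    -- solution of the recursion
    (∃ a : ℕ → ℤ → ℝ,
      (∀ b : ℕ → ℤ → ℝ, IsVExpansion b ↔ b = a) ∧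
      (∀ b : ℕ → ℤ → ℝ, SatisfiesVRecursion b ↔ b = a)) := by
  refine ⟨fun N m hN => ?_, fun g m h => ?_, fun g x hx => (hasSum_genusMeanTerm g hx).summable,
    tendsto_genusMean, vCoeff, isVExpansion_iff, satisfiesVRecursion_iff⟩
  · rw [laguerreMoment_eq_sum N m (m / 2 + 1) hN (by omega)]
    simp_rw [genusCoeff_eq_momentCoeff]
  · rw [genusCoeff_eq_momentCoeff, momentCoeff_eq_zero h]
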